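/- Let all Hilbert spaces be finite-dimensional and non-zero. A state is a positive semidefinite operator of trace one. A channel is a linear map $\Phi : B(\mathcal H)\to B(\mathcal H')$ that is completely positive (i.e. $I\otimes\Phi$ is positive on $B(\mathbb C^K\otimes\mathcal H)$ for every $K$) and trace-preserving. For a matrix $A$ and real $p\ge 1$ put $\|A\|_p=\big(\mathrm{Tr}\,(A^*A)^{p/2}\big)^{1/p}$, and let $$\nu_p(\Phi)=\sup_{\rho}\|\Phi(\rho)\|_p ,$$ the supremum running over all states $\rho$ on $\mathcal H$. Let $S(\rho)=-\mathrm{Tr}\,\rho\log\rho$ be the von Neumann entropy, and let $$\chi^*(\Phi)=\sup_{\{\pi_i,\rho_i\}}\Big[S\Big(\sum_i\pi_i\Phi(\rho_i)\Big)-\sum_i\pi_i S(\Phi(\rho_i))\Big]$$ be the Holevo capacity, the supremum running over all finite ensembles, that is, over all finite probability distributions $\{\pi_i\}$ and all collections of states $\{\rho_i\}$ on $\mathcal H$. Let $\{X_b\}$ be a finite family of positive semidefinite operators on $\mathcal H$ with $\sum_b X_b=I$ (a POVM), let $\{Q_b\}$ be states on $\mathcal H'$, and let $\Phi(\rho)=\sum_b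 \mathrm{Tr}(\rho X_b)\,Q_b$. The channel $\Phi$ is called a CQ channel if $X_b=|e_b\rangle\langle e_b|$ for an orthonormal basis $\{e_b\}$ of $\mathcal H$, and a QC channel if $Q_b=|e_b\rangle\langle e_b|$ for orthonormal vectors $\{e_b\}$ in $\mathcal H'$. **Theorem.** Let $\Phi$ be a CQ or QC channel. Then for every completely positive trace-preserving map $\Omega : B(\mathcal K)\to B(\mathcal K')$, $$\nu_p(\Omega\otimes\Phi)=\nu_p(\Omega)\,\nu_p(\Phi)\quad\text{for all real } p\ge 1,$$ and $$\chi^*(\Omega\otimes\Phi)=\chi^*(\Omega)+\chi^*(\Phi).$$ -/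

import Mathlib

namespace QuantumChannel

open scoped Kronecker ComplexOrder

/-! Finite-dimensional quantum systems: a finite type `m` indexes an orthonormal basis of the
Hilbert space, and operators on it are the matrices `Matrix m m ℂ`. -/

/-- A (quantum) state: a positive semidefinite matrix of trace one. -/
def IsState {m : Type*} [Fintype m] (ρ : Matrix m m ℂ) : Prop :=
  ρ.PosSemidef ∧ ρ.trace = 1

/-- The tensor product `Ω ⊗ Φ` of two linear maps on matrices; on product matrices it is
`A ⊗ B ↦ Ω A ⊗ Φ B` (see `tensorMap_kronecker`). -/
noncomputable def tensorMap {m m' n n' : Type*}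
    [Fintype m] [DecidableEq m] [Fintype m'] [DecidableEq m']
    [Fintype n] [DecidableEq n] [Fintype n'] [DecidableEq n']
    (Ω : Matrix m m ℂ →ₗ[ℂ] Matrix m' m' ℂ) (Φ : Matrix n n ℂ →ₗ[ℂ] Matrix n' n' ℂ) :
    Matrix (m × n) (m × n) ℂ →ₗ[ℂ] Matrix (m' × n') (m' × n') ℂ :=
  (kroneckerLinearEquiv m' m' n' n' ℂ).toLinearMap ∘ₗ
    TensorProduct.map Ω Φ ∘ₗ (kroneckerLinearEquiv m m n n ℂ).symm.toLinearMap

theorem tensorMap_kronecker {m m' n n' : Type*}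
    [Fintype m] [DecidableEq m] [Fintype m'] [DecidableEq m']
    [Fintype n] [DecidableEq n] [Fintype n'] [DecidableEq n']
    (Ω : Matrix m m ℂ →ₗ[ℂ] Matrix m' m' ℂ) (Φ : Matrix n n ℂ →ₗ[ℂ] Matrix n' n' ℂ)
    (A : Matrix m m ℂ) (B : Matrix n n ℂ) :
    tensorMap Ω Φ (A ⊗ₖ B) = Ω A ⊗ₖ Φ B := by
  simp [tensorMap]

/-- Complete positivity: `I ⊗ Φ` is positive on `B(ℂ^K ⊗ H)` for every `K`. -/
def IsCompletelyPositive {m m' : Type*}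
    [Fintype m] [DecidableEq m] [Fintype m'] [DecidableEq m']
    (Φ : Matrix m m ℂ →ₗ[ℂ] Matrix m' m' ℂ) : Prop :=
  ∀ (K : ℕ) (M : Matrix (Fin K × m) (Fin K × m) ℂ), M.PosSemidef →
    (tensorMap (LinearMap.id : Matrix (Fin K) (Fin K) ℂ →ₗ[ℂ] Matrix (Fin K) (Fin K) ℂ)
      Φ M).PosSemidef

/-- A completely positive trace-preserving map. -/
def IsCPTP {m m' : Type*} [Fintype m] [DecidableEq m] [Fintype m'] [DecidableEq m']
    (Φ : Matrix m m ℂ →ₗ[ℂ] Matrix m' m' ℂ) : Prop :=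
  IsCompletelyPositive Φ ∧ ∀ A : Matrix m m ℂ, (Φ A).trace = A.trace

/-- A POVM: positive semidefinite matrices that sum to the identity. -/
def IsPOVM {n : Type*} [DecidableEq n] {k : ℕ} (X : Fin k → Matrix n n ℂ) : Prop :=
  (∀ b, (X b).PosSemidef) ∧ ∑ b, X b = 1

/-- The map `ρ ↦ ∑ b, Tr (ρ X_b) Q_b`. -/
noncomputable def measurePrepare {n n' : Type*} [Fintype n] {k : ℕ}
    (X : Fin k → Matrix n n ℂ) (Q : Fin k → Matrix n' n' ℂ) :
    Matrix n n ℂ →ₗ[ℂ] Matrix n' n' ℂ where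
  toFun ρ := ∑ b, (ρ * X b).trace • Q b
  map_add' A B := by simp [add_mul, add_smul, Finset.sum_add_distrib]
  map_smul' c A := by simp [Finset.smul_sum, smul_smul]

/-- The rank-one matrix `|v⟩⟨v|`. -/
def ketBra {n : Type*} (v : EuclideanSpace ℂ n) : Matrix n n ℂ :=
  Matrix.vecMulVec (fun i => v i) (fun i => star (v i))

/-- CQ channels: `Φ(ρ) = ∑ b, Tr (ρ X_b) Q_b`, where the `Q_b` are states and the
`X_b = |e_b⟩⟨e_b|` are the projections onto an orthonormal basis. -/
def IsCQ {n n' : Type*} [Fintype n] [DecidableEq n] [Fintype n']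
    (Φ : Matrix n n ℂ →ₗ[ℂ] Matrix n' n' ℂ) : Prop :=
  ∃ (k : ℕ) (X : Fin k → Matrix n n ℂ) (Q : Fin k → Matrix n' n' ℂ),
    IsPOVM X ∧ (∀ b, IsState (Q b)) ∧
    (∃ e : OrthonormalBasis (Fin k) ℂ (EuclideanSpace ℂ n), ∀ b, X b = ketBra (e b)) ∧
    Φ = measurePrepare X Q

/-- QC channels: `Φ(ρ) = ∑ b, Tr (ρ X_b) Q_b`, where `X` is a POVM and the
`Q_b = |e_b⟩⟨e_b|` are the projections onto orthonormal vectors. -/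
def IsQC {n n' : Type*} [Fintype n] [DecidableEq n] [Fintype n']
    (Φ : Matrix n n ℂ →ₗ[ℂ] Matrix n' n' ℂ) : Prop :=
  ∃ (k : ℕ) (X : Fin k → Matrix n n ℂ) (Q : Fin k → Matrix n' n' ℂ),
    IsPOVM X ∧ (∀ b, IsState (Q b)) ∧
    (∃ e : Fin k → EuclideanSpace ℂ n', Orthonormal ℂ e ∧ ∀ b, Q b = ketBra (e b)) ∧
    Φ = measurePrepare X Q

/-- `Tr f(A)` for a Hermitian matrix `A`, where `f(A)` is given by the functional calculus. -/
noncomputable def traceFun {m : Type*} [Fintype m] [DecidableEq m]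
    (f : ℝ → ℝ) (A : Matrix m m ℂ) : ℝ :=
  (cfc f A).trace.re

theorem traceFun_eq_sum {m : Type*} [Fintype m] [DecidableEq m]
    (f : ℝ → ℝ) {A : Matrix m m ℂ} (hA : A.IsHermitian) :
    traceFun f A = ∑ i, f (hA.eigenvalues i) := by
  rw [traceFun, hA.cfc_eq, Matrix.IsHermitian.cfc, Unitary.conjStarAlgAut_apply,
    Matrix.trace_mul_cycle]
  simp [Matrix.trace]

/-- The noncommutative `l_p` norm `‖A‖_p = (Tr (A* A)^{p/2})^{1/p}`. -/
noncomputable def lpNorm {m : Type*} [Fintype m] [DecidableEq m]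
    (p : ℝ) (A : Matrix m m ℂ) : ℝ :=
  traceFun (fun x => x ^ (p / 2)) (A.conjTranspose * A) ^ (1 / p)

/-- The maximal output `l_p` norm `ν_p(Φ) = sup_ρ ‖Φ(ρ)‖_p`, `ρ` running over all states
(the set is bounded: `bddAbove_lpNorm`). -/
noncomputable def maxOutputNorm {m m' : Type*} [Fintype m] [Fintype m'] [DecidableEq m']
    (p : ℝ) (Φ : Matrix m m ℂ →ₗ[ℂ] Matrix m' m' ℂ) : ℝ :=
  sSup {x : ℝ | ∃ ρ : Matrix m m ℂ, IsState ρ ∧ lpNorm p (Φ ρ) = x}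

/-- The von Neumann entropy `S(ρ) = -Tr ρ log ρ` (with `0 log 0 = 0`). -/
noncomputable def entropy {m : Type*} [Fintype m] [DecidableEq m] (ρ : Matrix m m ℂ) : ℝ :=
  traceFun Real.negMulLog ρ

/-- `χ(Φ; E) = S(∑ π_i Φ(ρ_i)) - ∑ π_i S(Φ(ρ_i))` for an ensemble `E = {π_i, ρ_i}`. -/
noncomputable def holevoQuantity {m m' : Type*} [Fintype m'] [DecidableEq m']
    (Φ : Matrix m m ℂ →ₗ[ℂ] Matrix m' m' ℂ) {k : ℕ} (π : Fin k → ℝ)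
    (ρ : Fin k → Matrix m m ℂ) : ℝ :=
  entropy (∑ i, (π i : ℂ) • Φ (ρ i)) - ∑ i, π i * entropy (Φ (ρ i))

/-- The Holevo capacity `χ*(Φ)`: the supremum of `χ(Φ; E)` over all finite ensembles `E` of
states (the set is bounded: `bddAbove_holevoQuantity`). -/
noncomputable def holevoCapacity {m m' : Type*} [Fintype m] [Fintype m'] [DecidableEq m']
    (Φ : Matrix m m ℂ →ₗ[ℂ] Matrix m' m' ℂ) : ℝ :=
  sSup {x : ℝ | ∃ (k : ℕ) (π : Fin k → ℝ) (ρ : Fin k → Matrix m m ℂ),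
    π ∈ stdSimplex ℝ (Fin k) ∧ (∀ i, IsState (ρ i)) ∧ holevoQuantity Φ π ρ = x}

/-! The suprema above are suprema of bounded sets. -/

theorem sum_normSq_le_of_isState {m : Type*} [Fintype m] {ρ : Matrix m m ℂ}
    (h : IsState ρ) : ∑ i, ∑ j, ‖ρ i j‖ ^ 2 ≤ 1 := by
  classical
  have h0 := h.1.eigenvalues_nonneg
  have h1 : ∑ i, h.1.1.eigenvalues i = 1 := by
    have := h.1.1.trace_eq_sum_eigenvalues.symm.trans h.2
    simpa using congrArg Complex.re this
  have h2 : ∑ i, ∑ j, ‖ρ i j‖ ^ 2 = traceFun (fun x => x ^ 2) ρ := by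
    rw [traceFun, cfc_pow_id (R := ℝ) ρ 2 h.1.1.isSelfAdjoint, pow_two,
      show ρ * ρ = ρ * ρ.conjTranspose by rw [h.1.1.eq]]
    simp only [Matrix.trace, Matrix.diag_apply, Matrix.mul_apply, Matrix.conjTranspose_apply,
      Complex.re_sum]
    refine Finset.sum_congr rfl fun i _ => Finset.sum_congr rfl fun j _ => ?_
    rw [← Complex.normSq_eq_norm_sq, ← Complex.ofReal_re (Complex.normSq _),
      Complex.normSq_eq_conj_mul_self, mul_comm]
    rfl
  rw [h2, traceFun_eq_sum _ h.1.1, ← h1]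
  refine Finset.sum_le_sum fun i _ => ?_
  have : h.1.1.eigenvalues i ≤ 1 := by
    rw [← h1]; exact Finset.single_le_sum (fun j _ => h0 j) (Finset.mem_univ i)
  nlinarith [h0 i]

/-- Linear images of states have uniformly bounded entries. -/
theorem exists_norm_sq_bound {m m' : Type*} [Fintype m] [Fintype m']
    (Φ : Matrix m m ℂ →ₗ[ℂ] Matrix m' m' ℂ) :
    ∃ C : ℝ, ∀ ρ, IsState ρ → ((Φ ρ).conjTranspose * Φ ρ).trace.re ≤ C := by
  have hc : Continuous fun ρ : Matrix m m ℂ => ((Φ ρ).conjTranspose * Φ ρ).trace.re := by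
    have hΦ : Continuous Φ := Φ.continuous_of_finiteDimensional
    fun_prop
  have hK : IsCompact (Set.univ.pi fun _ => Set.univ.pi fun _ => Metric.closedBall 0 1 :
      Set (m → m → ℂ)) :=
    isCompact_univ_pi fun _ => isCompact_univ_pi fun _ => isCompact_closedBall 0 1
  obtain ⟨C, hC⟩ := hK.bddAbove_image hc.continuousOn
  refine ⟨C, fun ρ hρ => hC ⟨ρ, ?_, rfl⟩⟩
  intro i _ j _
  rw [mem_closedBall_zero_iff]
  have h1 : ‖ρ i j‖ ^ 2 ≤ ∑ j, ‖ρ i j‖ ^ 2 :=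
    Finset.single_le_sum (f := fun j => ‖ρ i j‖ ^ 2) (fun _ _ => by positivity)
      (Finset.mem_univ j)
  have h2 : ∑ j, ‖ρ i j‖ ^ 2 ≤ ∑ i, ∑ j, ‖ρ i j‖ ^ 2 :=
    Finset.single_le_sum (f := fun i => ∑ j, ‖ρ i j‖ ^ 2) (fun _ _ => by positivity)
      (Finset.mem_univ i)
  have h3 := sum_normSq_le_of_isState hρ
  have : ‖ρ i j‖ ^ 2 ≤ 1 ^ 2 := by linarith
  exact (sq_le_sq₀ (norm_nonneg _) zero_le_one).1 this

theorem bddAbove_lpNorm {m m' : Type*} [Fintype m] [Fintype m'] [DecidableEq m']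
    {p : ℝ} (hp : 1 ≤ p) (Φ : Matrix m m ℂ →ₗ[ℂ] Matrix m' m' ℂ) :
    BddAbove {x : ℝ | ∃ ρ : Matrix m m ℂ, IsState ρ ∧ lpNorm p (Φ ρ) = x} := by
  obtain ⟨C, hC⟩ := exists_norm_sq_bound Φ
  refine ⟨(∑ _i : m', C ^ (p / 2)) ^ (1 / p), ?_⟩
  rintro _ ⟨ρ, hρ, rfl⟩
  have hP := Matrix.posSemidef_conjTranspose_mul_self (Φ ρ)
  have h0 := hP.eigenvalues_nonneg
  have htr : ((Φ ρ).conjTranspose * Φ ρ).trace.re = ∑ i, hP.1.eigenvalues i := by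
    rw [hP.1.trace_eq_sum_eigenvalues]; simp
  rw [lpNorm, traceFun_eq_sum _ hP.1]
  refine Real.rpow_le_rpow (Finset.sum_nonneg fun i _ => Real.rpow_nonneg (h0 i) _) ?_
    (by positivity)
  refine Finset.sum_le_sum fun i _ => Real.rpow_le_rpow (h0 i) ?_ (by positivity)
  refine le_trans ?_ (hC ρ hρ)
  rw [htr]
  exact Finset.single_le_sum (fun j _ => h0 j) (Finset.mem_univ i)

/-- Entropies of linear images of states are uniformly bounded. -/
theorem exists_entropy_bound {m m' : Type*} [Fintype m] [Fintype m'] [DecidableEq m']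
    (Φ : Matrix m m ℂ →ₗ[ℂ] Matrix m' m' ℂ) :
    ∃ C : ℝ, ∀ ρ, IsState ρ → |entropy (Φ ρ)| ≤ C := by
  obtain ⟨C, hC⟩ := exists_norm_sq_bound Φ
  obtain ⟨D, hD⟩ := (isCompact_Icc (a := -(|C| + 1)) (b := |C| + 1)).bddAbove_image
    (f := fun x => |Real.negMulLog x|) (Real.continuous_negMulLog.abs.continuousOn)
  have hD0 : 0 ≤ D := (abs_nonneg _).trans
    (hD ⟨0, ⟨by linarith [abs_nonneg C], by positivity⟩, rfl⟩)
  refine ⟨∑ _i : m', D, fun ρ hρ => ?_⟩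
  by_cases hA : (Φ ρ).IsHermitian
  · rw [entropy, traceFun_eq_sum _ hA]
    refine (Finset.abs_sum_le_sum_abs _ _).trans (Finset.sum_le_sum fun i _ => ?_)
    refine hD ⟨hA.eigenvalues i, ?_, rfl⟩
    have h1 : ((Φ ρ).conjTranspose * Φ ρ).trace.re = ∑ i, hA.eigenvalues i ^ 2 := by
      rw [← traceFun_eq_sum (fun x => x ^ 2) hA, traceFun,
        cfc_pow_id (R := ℝ) (Φ ρ) 2 hA.isSelfAdjoint, pow_two, hA.eq]
    have h2 : hA.eigenvalues i ^ 2 ≤ C := by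
      refine le_trans ?_ (hC ρ hρ)
      rw [h1]
      exact Finset.single_le_sum (f := fun i => hA.eigenvalues i ^ 2)
        (fun j _ => sq_nonneg _) (Finset.mem_univ i)
    have h3 := le_abs_self C
    have h4 := abs_nonneg C
    exact ⟨by nlinarith, by nlinarith⟩
  · have : cfc Real.negMulLog (Φ ρ) = 0 := cfc_apply_of_not_predicate _ hA
    rw [entropy, traceFun, this]
    simp only [Matrix.trace_zero, Complex.zero_re, abs_zero]
    exact Finset.sum_nonneg fun (_ : m') _ => hD0

theorem bddAbove_holevoQuantity {m m' : Type*} [Fintype m] [Fintype m'] [DecidableEq m']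
    (Φ : Matrix m m ℂ →ₗ[ℂ] Matrix m' m' ℂ) :
    BddAbove {x : ℝ | ∃ (k : ℕ) (π : Fin k → ℝ) (ρ : Fin k → Matrix m m ℂ),
      π ∈ stdSimplex ℝ (Fin k) ∧ (∀ i, IsState (ρ i)) ∧ holevoQuantity Φ π ρ = x} := by
  obtain ⟨C, hC⟩ := exists_entropy_bound Φ
  refine ⟨C + C, ?_⟩
  rintro _ ⟨k, π, ρ, hπ, hρ, rfl⟩
  have havg : IsState (∑ i, (π i : ℂ) • ρ i) := by
    refine ⟨Matrix.posSemidef_sum _ fun i _ => (hρ i).1.smul ?_, ?_⟩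
    · exact_mod_cast hπ.1 i
    · simp only [Matrix.trace_sum, Matrix.trace_smul, (hρ _).2, smul_eq_mul, mul_one]
      exact_mod_cast hπ.2
  have h1 := hC _ havg
  simp only [map_sum, map_smul] at h1
  have h2 : ∑ i, π i * -entropy (Φ (ρ i)) ≤ ∑ i, π i * C :=
    Finset.sum_le_sum fun i _ => mul_le_mul_of_nonneg_left
      ((neg_le_abs _).trans (hC _ (hρ i))) (hπ.1 i)
  rw [← Finset.sum_mul, hπ.2, one_mul] at h2
  simp only [mul_neg, Finset.sum_neg_distrib] at h2
  have h3 := le_abs_self (entropy (∑ i, (π i : ℂ) • Φ (ρ i)))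
  rw [holevoQuantity]
  linarith

end QuantumChannel

/-!
Both suprema are bounded below by product inputs, since `‖A ⊗ B‖_p = ‖A‖_p ‖B‖_p` and
`S(A ⊗ B) = S(A) + S(B)`. The content is the upper bound. The output of `Ω ⊗ Φ` on a state `τ` is
a mixture `∑ b, x_b Ω(ρ_b) ⊗ Q_b`, where `x_b` is the probability of the outcome `b` when the POVM
is measured on the second factor and `ρ_b` is the state in which the first factor is then left;
`Φ` maps the marginal of `τ` to `∑ b, x_b Q_b` (`exists_tensorMap_measurePrepare_eq`). No
entanglement is left between the two factors.

For a QC channel the mixture is block diagonal with blocks `x_b Ω(ρ_b)`, and `Tr f` is the sum over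
the blocks. For the norm this gives `∑ b, x_b^p ‖Ω(ρ_b)‖_p^p ≤ ν_p(Ω)^p ∑ b, x_b^p`. The entropy
splits into the Shannon entropy of `x`, which is the output entropy of `Φ`, and the average of the
entropies of `Ω(ρ_b)`; the Holevo quantity of an ensemble is then the one of `Φ` on the marginals
plus an average over `b` of Holevo quantities of `Ω`.

For a CQ channel each `Q_b = Φ(|e_b⟩⟨e_b|)` is itself an output of `Φ`. Convexity of `Tr (·)^p`
bounds the norm of the mixture by those of the products `Ω(ρ_b) ⊗ Q_b`. For the capacity, concavity
of the entropy allows each output to be replaced by the ensemble of the products that it is made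
of, and subadditivity of the entropy splits the Holevo quantity into one for `Ω` and one for `Φ`.

Convexity of `Tr f`, concavity of the entropy and its subadditivity all follow from Peierls'
inequality `∑ i, f ⟨u_i, A u_i⟩ ≤ Tr f(A)` (`sum_diag_le_traceFun`). Spectral sums are computed by
`traceFun_mul_diagonal_mul`, from any diagonalization by orthonormal columns.
-/

namespace QuantumChannel

open Matrix
open scoped Kronecker ComplexOrder

/-! ### Spectral sums -/

/-- If the columns of `V` are orthonormal, then `V * diagonal d * Vᴴ` has the entries of `d` as its
eigenvalues, up to zeros, which `f` kills. The number of columns may differ from the number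
of rows. -/
theorem traceFun_mul_diagonal_mul {ι m : Type*} [Fintype ι] [DecidableEq ι]
    [Fintype m] [DecidableEq m] {f : ℝ → ℝ} (hf : f 0 = 0) {V : Matrix m ι ℂ}
    (hV : Vᴴ * V = 1) (d : ι → ℝ) :
    traceFun f (V * diagonal (fun i => (d i : ℂ)) * Vᴴ) = ∑ i, f (d i) := by
  have hD : (diagonal (fun i => (d i : ℂ))).IsHermitian := by
    rw [IsHermitian, diagonal_conjTranspose]
    congr 1
    ext i
    simp
  have hA : (V * diagonal (fun i => (d i : ℂ)) * Vᴴ).IsHermitian :=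
    isHermitian_mul_mul_conjTranspose V hD
  have hne : ∀ s : ι → ℂ, ∏ i, (Polynomial.X - Polynomial.C (s i)) ≠ 0 := fun s =>
    Finset.prod_ne_zero_iff.2 fun i _ => Polynomial.X_sub_C_ne_zero _
  have h := charpoly_mul_comm' (V * diagonal (fun i => (d i : ℂ))) Vᴴ
  rw [← Matrix.mul_assoc, hV, Matrix.one_mul, charpoly_diagonal] at h
  replace h := congrArg (fun P => (P.roots.map (fun z : ℂ => f z.re)).sum) h
  rw [Polynomial.roots_mul (mul_ne_zero (pow_ne_zero _ Polynomial.X_ne_zero)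
      (Matrix.charpoly_monic _).ne_zero),
    Polynomial.roots_mul (mul_ne_zero (pow_ne_zero _ Polynomial.X_ne_zero) (hne _)),
    hA.roots_charpoly_eq_eigenvalues, Polynomial.roots_prod _ _ (hne _)] at h
  rw [traceFun_eq_sum _ hA]
  simpa [hf, Function.comp_def, Multiset.map_nsmul, Multiset.sum_nsmul] using h

theorem exists_eq_mul_diagonal_mul {m : Type*} [Fintype m] [DecidableEq m] {A : Matrix m m ℂ}
    (hA : A.PosSemidef) :
    ∃ (U : Matrix m m ℂ) (d : m → ℝ), Uᴴ * U = 1 ∧ U * Uᴴ = 1 ∧ (∀ i, 0 ≤ d i) ∧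
      A = U * diagonal (fun i => (d i : ℂ)) * Uᴴ := by
  refine ⟨hA.1.eigenvectorUnitary, hA.1.eigenvalues, ?_, ?_, hA.eigenvalues_nonneg, ?_⟩
  · exact Unitary.coe_star_mul_self hA.1.eigenvectorUnitary
  · exact Unitary.coe_mul_star_self hA.1.eigenvectorUnitary
  · exact hA.1.spectral_theorem

theorem mul_diagonal_mul_conjTranspose_apply_self {ι m : Type*} [Fintype ι] [DecidableEq ι]
    (C : Matrix m ι ℂ) (d : ι → ℝ) (i : m) :
    (C * diagonal (fun i => (d i : ℂ)) * Cᴴ) i i =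
      ((∑ j, Complex.normSq (C i j) * d j : ℝ) : ℂ) := by
  rw [Matrix.mul_apply, Complex.ofReal_sum]
  refine Finset.sum_congr rfl fun j _ => ?_
  rw [mul_diagonal, conjTranspose_apply, Complex.ofReal_mul, ← Complex.mul_conj]
  simp only [RCLike.star_def]
  ring

theorem sum_normSq_row {ι m : Type*} [Fintype ι] [DecidableEq m] {C : Matrix m ι ℂ}
    (hC : C * Cᴴ = 1) (i : m) : ∑ j, Complex.normSq (C i j) = 1 := by
  have h := congrFun (congrFun hC i) i
  rw [Matrix.mul_apply, one_apply_eq] at h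
  have h' : ((∑ j, Complex.normSq (C i j) : ℝ) : ℂ) = 1 := by
    rw [← h, Complex.ofReal_sum]
    refine Finset.sum_congr rfl fun j _ => ?_
    rw [← Complex.mul_conj, conjTranspose_apply, RCLike.star_def]
  exact_mod_cast h'

/-- Peierls' inequality: the diagonal entries of `A` in an orthonormal basis are averages of the
eigenvalues of `A` with doubly stochastic weights. -/
theorem sum_diag_le_traceFun {m : Type*} [Fintype m] [DecidableEq m] {f : ℝ → ℝ}
    (hf : ConvexOn ℝ (Set.Ici 0) f) (hf0 : f 0 = 0) {A : Matrix m m ℂ} (hA : A.PosSemidef)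
    {W : Matrix m m ℂ} (hW : Wᴴ * W = 1) :
    ∑ i, f ((Wᴴ * A * W) i i).re ≤ traceFun f A := by
  have hW' : W * Wᴴ = 1 := mul_eq_one_comm.1 hW
  obtain ⟨U, d, hU, hU', hd, rfl⟩ := exists_eq_mul_diagonal_mul hA
  rw [traceFun_mul_diagonal_mul hf0 hU]
  set C := Wᴴ * U with hCdef
  have hCH : Cᴴ = Uᴴ * W := by simp [hCdef]
  have hC : C * Cᴴ = 1 := by
    rw [hCH, hCdef, Matrix.mul_assoc, ← Matrix.mul_assoc U, hU', Matrix.one_mul, hW]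
  have hC' : Cᴴ * Cᴴᴴ = 1 := by
    rw [conjTranspose_conjTranspose]
    exact mul_eq_one_comm.1 hC
  have hcol : ∀ j, ∑ i, Complex.normSq (C i j) = 1 := fun j => by
    have := sum_normSq_row hC' j
    simpa [conjTranspose_apply, Complex.normSq_conj] using this
  have hWA : Wᴴ * (U * diagonal (fun i => (d i : ℂ)) * Uᴴ) * W =
      C * diagonal (fun i => (d i : ℂ)) * Cᴴ := by
    rw [hCH, hCdef]
    simp only [Matrix.mul_assoc]
  rw [hWA]
  calc ∑ i, f ((C * diagonal (fun i => (d i : ℂ)) * Cᴴ) i i).re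
      = ∑ i, f (∑ j, Complex.normSq (C i j) • d j) := by
        simp only [mul_diagonal_mul_conjTranspose_apply_self, Complex.ofReal_re, smul_eq_mul]
    _ ≤ ∑ i, ∑ j, Complex.normSq (C i j) • f (d j) :=
        Finset.sum_le_sum fun i _ => hf.map_sum_le (fun j _ => Complex.normSq_nonneg _)
          (sum_normSq_row hC i) fun j _ => hd j
    _ = ∑ j, f (d j) := by
        rw [Finset.sum_comm]
        simp only [smul_eq_mul, ← Finset.sum_mul, hcol, one_mul]

theorem conjTranspose_mul_conj_mul {m : Type*} [Fintype m] [DecidableEq m]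
    {U : Matrix m m ℂ} (hU : Uᴴ * U = 1) (D : Matrix m m ℂ) : Uᴴ * (U * D * Uᴴ) * U = D := by
  simp only [Matrix.mul_assoc, hU, Matrix.mul_one]
  rw [← Matrix.mul_assoc, hU, Matrix.one_mul]

theorem diag_conjTranspose_mul_sum_mul {ι m : Type*} [Fintype ι] [Fintype m] (c : ι → ℝ)
    (A : ι → Matrix m m ℂ) (U : Matrix m m ℂ) (i : m) :
    ((Uᴴ * (∑ b, (c b : ℂ) • A b) * U) i i).re = ∑ b, c b • ((Uᴴ * A b * U) i i).re := by
  simp [Finset.mul_sum, Finset.sum_mul, Matrix.sum_apply]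

/-- `Tr f` is convex on positive semidefinite matrices: Peierls' inequality is applied in an
eigenbasis of the average. -/
theorem traceFun_sum_smul_le {ι m : Type*} [Fintype ι] [Fintype m] [DecidableEq m] {f : ℝ → ℝ}
    (hf : ConvexOn ℝ (Set.Ici 0) f) (hf0 : f 0 = 0) {A : ι → Matrix m m ℂ}
    (hA : ∀ b, (A b).PosSemidef) {c : ι → ℝ} (hc : c ∈ stdSimplex ℝ ι) :
    traceFun f (∑ b, (c b : ℂ) • A b) ≤ ∑ b, c b * traceFun f (A b) := by
  have hS : (∑ b, (c b : ℂ) • A b).PosSemidef :=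
    posSemidef_sum _ fun b _ => (hA b).smul (by exact_mod_cast hc.1 b)
  obtain ⟨U, d, hU, hU', hd, hSd⟩ := exists_eq_mul_diagonal_mul hS
  have hdiag : ∀ i, d i = ∑ b, c b • ((Uᴴ * A b * U) i i).re := fun i => by
    rw [← diag_conjTranspose_mul_sum_mul, hSd, conjTranspose_mul_conj_mul hU]
    simp
  calc traceFun f (∑ b, (c b : ℂ) • A b) = ∑ i, f (d i) := by
        rw [hSd, traceFun_mul_diagonal_mul hf0 hU]
    _ ≤ ∑ i, ∑ b, c b • f ((Uᴴ * A b * U) i i).re := by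
        refine Finset.sum_le_sum fun i _ => ?_
        rw [hdiag i]
        refine hf.map_sum_le (fun b _ => hc.1 b) hc.2 fun b _ => ?_
        exact (Complex.le_def.1 ((hA b).conjTranspose_mul_mul_same U).diag_nonneg).1
    _ = ∑ b, c b * ∑ i, f ((Uᴴ * A b * U) i i).re := by
        rw [Finset.sum_comm]
        simp only [smul_eq_mul, Finset.mul_sum]
    _ ≤ _ := Finset.sum_le_sum fun b _ =>
        mul_le_mul_of_nonneg_left (sum_diag_le_traceFun hf hf0 (hA b) hU) (hc.1 b)

theorem traceFun_smul {m : Type*} [Fintype m] [DecidableEq m] {f g : ℝ → ℝ} (hf : f 0 = 0)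
    (hg : g 0 = 0) (c : ℝ) (hfg : ∀ x, 0 ≤ x → f (c * x) = g x) {A : Matrix m m ℂ}
    (hA : A.PosSemidef) : traceFun f ((c : ℂ) • A) = traceFun g A := by
  obtain ⟨U, d, hU, -, hd, rfl⟩ := exists_eq_mul_diagonal_mul hA
  have h : (c : ℂ) • (U * diagonal (fun i => (d i : ℂ)) * Uᴴ) =
      U * diagonal (fun i => ((c * d i : ℝ) : ℂ)) * Uᴴ := by
    rw [← Matrix.smul_mul, ← Matrix.mul_smul, ← diagonal_smul]
    congr 3
    ext i
    simp
  rw [h, traceFun_mul_diagonal_mul hf hU, traceFun_mul_diagonal_mul hg hU]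
  exact Finset.sum_congr rfl fun i _ => hfg _ (hd i)

theorem trace_mul_diagonal_mul {m : Type*} [Fintype m] [DecidableEq m] {U : Matrix m m ℂ}
    (hU : Uᴴ * U = 1) (d : m → ℝ) :
    (U * diagonal (fun i => (d i : ℂ)) * Uᴴ).trace = ((∑ i, d i : ℝ) : ℂ) := by
  rw [trace_mul_cycle, hU, Matrix.one_mul, trace_diagonal, Complex.ofReal_sum]

theorem traceFun_kronecker {m n : Type*} [Fintype m] [DecidableEq m] [Fintype n] [DecidableEq n]
    {f : ℝ → ℝ} (hf : f 0 = 0) {U : Matrix m m ℂ} (hU : Uᴴ * U = 1) {W : Matrix n n ℂ}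
    (hW : Wᴴ * W = 1) (d : m → ℝ) (e : n → ℝ) :
    traceFun f ((U * diagonal (fun i => (d i : ℂ)) * Uᴴ) ⊗ₖ
      (W * diagonal (fun i => (e i : ℂ)) * Wᴴ)) = ∑ i, ∑ j, f (d i * e j) := by
  have hUW : (U ⊗ₖ W)ᴴ * (U ⊗ₖ W) = 1 := by
    rw [conjTranspose_kronecker, ← mul_kronecker_mul, hU, hW, one_kronecker_one]
  rw [mul_kronecker_mul, mul_kronecker_mul, diagonal_kronecker_diagonal, ← conjTranspose_kronecker]
  have := traceFun_mul_diagonal_mul hf hUW (fun p : m × n => d p.1 * e p.2)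
  simp only [Complex.ofReal_mul] at this
  rw [this, Fintype.sum_prod_type]

theorem sum_star_mul_of_orthonormal {ι n : Type*} [DecidableEq ι] [Fintype n]
    {e : ι → EuclideanSpace ℂ n} (he : Orthonormal ℂ e) (b c : ι) :
    ∑ j, star (e b j) * e c j = if b = c then 1 else 0 := by
  rw [← orthonormal_iff_ite.1 he b c, PiLp.inner_apply]
  exact Finset.sum_congr rfl fun j _ => by simp [mul_comm]

theorem traceFun_sum_smul_ketBra {ι n : Type*} [Fintype ι] [DecidableEq ι]
    [Fintype n] [DecidableEq n] {f : ℝ → ℝ} (hf : f 0 = 0) {e : ι → EuclideanSpace ℂ n}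
    (he : Orthonormal ℂ e) (x : ι → ℝ) :
    traceFun f (∑ b, (x b : ℂ) • ketBra (e b)) = ∑ b, f (x b) := by
  let V : Matrix n ι ℂ := of fun j b => e b j
  have hV : Vᴴ * V = 1 := by
    ext b c
    rw [Matrix.mul_apply, Matrix.one_apply, ← sum_star_mul_of_orthonormal he b c]
    rfl
  rw [← traceFun_mul_diagonal_mul hf hV x]
  congr 1
  ext i j
  rw [Matrix.mul_apply, Matrix.sum_apply]
  refine Finset.sum_congr rfl fun b _ => ?_
  simp only [mul_diagonal, conjTranspose_apply, V, of_apply, ketBra, vecMulVec_apply,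
    Matrix.smul_apply, smul_eq_mul]
  ring

/-- `Tr f` is additive over block diagonal matrices. -/
theorem traceFun_sum_kronecker_ketBra {ι m n : Type*} [Fintype ι] [DecidableEq ι] [Fintype m]
    [DecidableEq m] [Fintype n] [DecidableEq n] {f : ℝ → ℝ} (hf : f 0 = 0)
    {ω : ι → Matrix m m ℂ} (hω : ∀ b, (ω b).PosSemidef) {e : ι → EuclideanSpace ℂ n}
    (he : Orthonormal ℂ e) :
    traceFun f (∑ b, ω b ⊗ₖ ketBra (e b)) = ∑ b, traceFun f (ω b) := by
  choose U d hU _ _ hUd using fun b => exists_eq_mul_diagonal_mul (hω b)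
  let V : Matrix (m × n) (m × ι) ℂ := of fun p q => U q.2 p.1 q.1 * e q.2 p.2
  have hV : Vᴴ * V = 1 := by
    ext ⟨a, b⟩ ⟨a', b'⟩
    have h1 : (Vᴴ * V) (a, b) (a', b') =
        (∑ i, star (U b i a) * U b' i a') * ∑ j, star (e b j) * e b' j := by
      rw [Matrix.mul_apply, Fintype.sum_prod_type, Finset.sum_mul_sum]
      refine Finset.sum_congr rfl fun i _ => Finset.sum_congr rfl fun j _ => ?_
      simp only [V, conjTranspose_apply, of_apply, star_mul']
      ring
    rw [h1, sum_star_mul_of_orthonormal he]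
    by_cases hb : b = b'
    · subst hb
      have h2 := congrFun (congrFun (hU b) a) a'
      rw [Matrix.mul_apply] at h2
      simp only [conjTranspose_apply] at h2
      rw [h2]
      simp [Matrix.one_apply]
    · simp [hb]
  have hsum : ∑ b, ω b ⊗ₖ ketBra (e b) =
      V * diagonal (fun q : m × ι => (d q.2 q.1 : ℂ)) * Vᴴ := by
    ext ⟨i, j⟩ ⟨i', j'⟩
    rw [Matrix.mul_apply, Fintype.sum_prod_type_right, Matrix.sum_apply]
    refine Finset.sum_congr rfl fun b _ => ?_
    rw [kroneckerMap_apply, hUd b, Matrix.mul_apply, Finset.sum_mul]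
    refine Finset.sum_congr rfl fun a _ => ?_
    simp only [mul_diagonal, conjTranspose_apply, V, of_apply, ketBra, vecMulVec_apply, star_mul']
    ring
  rw [hsum, traceFun_mul_diagonal_mul hf hV, Fintype.sum_prod_type_right]
  refine Finset.sum_congr rfl fun b _ => ?_
  rw [hUd b, traceFun_mul_diagonal_mul hf (hU b)]

/-! ### The `l_p` norm and the entropy of positive semidefinite matrices -/

theorem lpNorm_eq_of_posSemidef {m : Type*} [Fintype m] [DecidableEq m] {p : ℝ} (hp : 1 ≤ p)
    {A : Matrix m m ℂ} (hA : A.PosSemidef) :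
    lpNorm p A = traceFun (fun x => x ^ p) A ^ (1 / p) := by
  obtain ⟨U, d, hU, -, hd, rfl⟩ := exists_eq_mul_diagonal_mul hA
  have h : U * diagonal (fun i => (d i : ℂ)) * Uᴴ * (U * diagonal (fun i => (d i : ℂ)) * Uᴴ) =
      U * diagonal (fun i => ((d i ^ 2 : ℝ) : ℂ)) * Uᴴ := by
    calc _ = U * diagonal (fun i => (d i : ℂ)) * (Uᴴ * U) * diagonal (fun i => (d i : ℂ)) * Uᴴ := by
          simp only [Matrix.mul_assoc]
      _ = _ := by
          rw [hU, Matrix.mul_one, Matrix.mul_assoc U, diagonal_mul_diagonal]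
          simp [sq]
  have h0 : (0 : ℝ) ^ p = 0 := Real.zero_rpow (by positivity)
  have h0' : (0 : ℝ) ^ (p / 2) = 0 := Real.zero_rpow (by positivity)
  rw [lpNorm, hA.1.eq, h, traceFun_mul_diagonal_mul h0' hU, traceFun_mul_diagonal_mul h0 hU]
  congr 1
  refine Finset.sum_congr rfl fun i _ => ?_
  rw [← Real.rpow_natCast, ← Real.rpow_mul (hd i)]
  congr 1
  push_cast
  ring

theorem traceFun_rpow_nonneg {m : Type*} [Fintype m] [DecidableEq m] (p : ℝ) {A : Matrix m m ℂ}
    (hA : A.PosSemidef) : 0 ≤ traceFun (fun x => x ^ p) A := by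
  rw [traceFun_eq_sum _ hA.1]
  exact Finset.sum_nonneg fun i _ => Real.rpow_nonneg (hA.eigenvalues_nonneg i) _

theorem lpNorm_nonneg {m : Type*} [Fintype m] [DecidableEq m] {p : ℝ} (hp : 1 ≤ p)
    {A : Matrix m m ℂ} (hA : A.PosSemidef) : 0 ≤ lpNorm p A := by
  rw [lpNorm_eq_of_posSemidef hp hA]
  exact Real.rpow_nonneg (traceFun_rpow_nonneg p hA) _

theorem traceFun_rpow_eq_lpNorm_rpow {m : Type*} [Fintype m] [DecidableEq m] {p : ℝ} (hp : 1 ≤ p)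
    {A : Matrix m m ℂ} (hA : A.PosSemidef) :
    traceFun (fun x => x ^ p) A = lpNorm p A ^ p := by
  rw [lpNorm_eq_of_posSemidef hp hA, ← Real.rpow_mul (traceFun_rpow_nonneg p hA),
    one_div_mul_cancel (by positivity), Real.rpow_one]

theorem lpNorm_le_iff {m : Type*} [Fintype m] [DecidableEq m] {p : ℝ} (hp : 1 ≤ p)
    {A : Matrix m m ℂ} (hA : A.PosSemidef) {c : ℝ} (hc : 0 ≤ c) :
    lpNorm p A ≤ c ↔ traceFun (fun x => x ^ p) A ≤ c ^ p := by
  rw [traceFun_rpow_eq_lpNorm_rpow hp hA,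
    Real.rpow_le_rpow_iff (lpNorm_nonneg hp hA) hc (by positivity)]

theorem traceFun_rpow_kronecker {m n : Type*} [Fintype m] [DecidableEq m] [Fintype n]
    [DecidableEq n] {p : ℝ} (hp : 1 ≤ p) {A : Matrix m m ℂ} (hA : A.PosSemidef)
    {B : Matrix n n ℂ} (hB : B.PosSemidef) :
    traceFun (fun x => x ^ p) (A ⊗ₖ B) =
      traceFun (fun x => x ^ p) A * traceFun (fun x => x ^ p) B := by
  have h0 : (0 : ℝ) ^ p = 0 := Real.zero_rpow (by positivity)
  obtain ⟨U, d, hU, -, hd, rfl⟩ := exists_eq_mul_diagonal_mul hA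
  obtain ⟨W, e, hW, -, he, rfl⟩ := exists_eq_mul_diagonal_mul hB
  rw [traceFun_kronecker h0 hU hW, traceFun_mul_diagonal_mul h0 hU,
    traceFun_mul_diagonal_mul h0 hW, Finset.sum_mul_sum]
  exact Finset.sum_congr rfl fun i _ => Finset.sum_congr rfl fun j _ =>
    Real.mul_rpow (hd i) (he j)

theorem lpNorm_kronecker {m n : Type*} [Fintype m] [DecidableEq m] [Fintype n]
    [DecidableEq n] {p : ℝ} (hp : 1 ≤ p) {A : Matrix m m ℂ} (hA : A.PosSemidef)
    {B : Matrix n n ℂ} (hB : B.PosSemidef) :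
    lpNorm p (A ⊗ₖ B) = lpNorm p A * lpNorm p B := by
  rw [lpNorm_eq_of_posSemidef hp hA, lpNorm_eq_of_posSemidef hp hB,
    lpNorm_eq_of_posSemidef hp (hA.kronecker hB), traceFun_rpow_kronecker hp hA hB,
    Real.mul_rpow (traceFun_rpow_nonneg p hA) (traceFun_rpow_nonneg p hB)]

theorem entropy_kronecker {m n : Type*} [Fintype m] [DecidableEq m] [Fintype n]
    [DecidableEq n] {A : Matrix m m ℂ} (hA : IsState A) {B : Matrix n n ℂ} (hB : IsState B) :
    entropy (A ⊗ₖ B) = entropy A + entropy B := by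
  have h0 := Real.negMulLog_zero
  obtain ⟨U, d, hU, -, -, rfl⟩ := exists_eq_mul_diagonal_mul hA.1
  obtain ⟨W, e, hW, -, -, rfl⟩ := exists_eq_mul_diagonal_mul hB.1
  have hd : ∑ i, d i = 1 := by
    have := hA.2
    rw [trace_mul_diagonal_mul hU] at this
    exact_mod_cast this
  have he : ∑ i, e i = 1 := by
    have := hB.2
    rw [trace_mul_diagonal_mul hW] at this
    exact_mod_cast this
  rw [entropy, entropy, entropy, traceFun_kronecker h0 hU hW, traceFun_mul_diagonal_mul h0 hU,
    traceFun_mul_diagonal_mul h0 hW]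
  simp only [Real.negMulLog_mul, Finset.sum_add_distrib, ← Finset.mul_sum, ← Finset.sum_mul, hd,
    he, one_mul]

/-- The entropy of a rescaled state; it carries the Shannon entropy of the weights when the
output is block diagonal. -/
theorem entropy_smul {m : Type*} [Fintype m] [DecidableEq m] (c : ℝ) {A : Matrix m m ℂ}
    (hA : IsState A) : entropy ((c : ℂ) • A) = Real.negMulLog c + c * entropy A := by
  obtain ⟨U, d, hU, -, -, hAd⟩ := exists_eq_mul_diagonal_mul hA.1
  have hd : ∑ i, d i = 1 := by
    have := hA.2
    rw [hAd, trace_mul_diagonal_mul hU] at this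
    exact_mod_cast this
  rw [entropy, traceFun_smul (g := fun x => Real.negMulLog (c * x)) Real.negMulLog_zero
    (by simp) c (fun _ _ => rfl) hA.1, entropy, hAd,
    traceFun_mul_diagonal_mul (by simp) hU, traceFun_mul_diagonal_mul Real.negMulLog_zero hU]
  simp only [Real.negMulLog_mul, Finset.sum_add_distrib, ← Finset.mul_sum, ← Finset.sum_mul, hd,
    one_mul]

theorem traceFun_mul_log {m : Type*} [Fintype m] [DecidableEq m] {A : Matrix m m ℂ}
    (hA : A.PosSemidef) : traceFun (fun x => x * Real.log x) A = -entropy A := by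
  rw [entropy, traceFun_eq_sum _ hA.1, traceFun_eq_sum _ hA.1, ← Finset.sum_neg_distrib]
  exact Finset.sum_congr rfl fun i _ => by simp [Real.negMulLog]

theorem sum_mul_entropy_le {ι m : Type*} [Fintype ι] [Fintype m] [DecidableEq m]
    {A : ι → Matrix m m ℂ} (hA : ∀ b, (A b).PosSemidef) {c : ι → ℝ} (hc : c ∈ stdSimplex ℝ ι) :
    ∑ b, c b * entropy (A b) ≤ entropy (∑ b, (c b : ℂ) • A b) := by
  have h := traceFun_sum_smul_le Real.convexOn_mul_log (by simp) hA hc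
  rw [traceFun_mul_log (posSemidef_sum _ fun b _ =>
    (hA b).smul (by exact_mod_cast hc.1 b : (0 : ℂ) ≤ (c b : ℂ)))] at h
  simp only [traceFun_mul_log (hA _), mul_neg, Finset.sum_neg_distrib] at h
  linarith

theorem entropy_le_sum_diag {m : Type*} [Fintype m] [DecidableEq m] {A : Matrix m m ℂ}
    (hA : A.PosSemidef) {W : Matrix m m ℂ} (hW : Wᴴ * W = 1) :
    entropy A ≤ ∑ i, Real.negMulLog ((Wᴴ * A * W) i i).re := by
  have h := sum_diag_le_traceFun Real.convexOn_mul_log (by simp) hA hW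
  rw [traceFun_mul_log hA] at h
  simp only [Real.negMulLog, neg_mul, Finset.sum_neg_distrib]
  linarith

/-! ### Subadditivity of the entropy -/

/-- The pointwise form of Gibbs' inequality. -/
theorem negMulLog_le_cross {p q : ℝ} (hp : 0 ≤ p) (hq : 0 ≤ q) (h : q = 0 → p = 0) :
    Real.negMulLog p ≤ -(p * Real.log q) + (q - p) := by
  rcases hp.eq_or_lt with rfl | hp
  · simpa using hq
  have hq : 0 < q := hq.lt_of_ne fun h0 => hp.ne' (h h0.symm)
  have h1 := mul_le_mul_of_nonneg_left (Real.log_le_sub_one_of_pos (div_pos hq hp)) hp.le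
  rw [Real.log_div hq.ne' hp.ne', mul_sub, mul_sub, mul_div_cancel₀ _ hp.ne'] at h1
  rw [Real.negMulLog]
  linarith

/-- Subadditivity of the Shannon entropy. -/
theorem sum_negMulLog_le {ι κ : Type*} [Fintype ι] [Fintype κ] {p : ι → κ → ℝ}
    (hp : ∀ i j, 0 ≤ p i j) (h1 : ∑ i, ∑ j, p i j = 1) :
    ∑ i, ∑ j, Real.negMulLog (p i j) ≤
      ∑ i, Real.negMulLog (∑ j, p i j) + ∑ j, Real.negMulLog (∑ i, p i j) := by
  set a : ι → ℝ := fun i => ∑ j, p i j with ha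
  set b : κ → ℝ := fun j => ∑ i, p i j with hb
  have hpa : ∀ i j, p i j ≤ a i := fun i j =>
    Finset.single_le_sum (f := fun j => p i j) (fun j _ => hp i j) (Finset.mem_univ j)
  have hpb : ∀ i j, p i j ≤ b j := fun i j =>
    Finset.single_le_sum (f := fun i => p i j) (fun i _ => hp i j) (Finset.mem_univ i)
  have hterm : ∀ i j, Real.negMulLog (p i j) ≤
      -(p i j * Real.log (a i)) - p i j * Real.log (b j) + (a i * b j - p i j) := fun i j => by
    rcases (hp i j).eq_or_lt with h | h
    · rw [← h]
      simpa using mul_nonneg ((hp i j).trans (hpa i j)) ((hp i j).trans (hpb i j))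
    · have ha0 := h.trans_le (hpa i j)
      have hb0 := h.trans_le (hpb i j)
      have := negMulLog_le_cross h.le (mul_pos ha0 hb0).le fun h0 =>
        absurd h0 (mul_pos ha0 hb0).ne'
      rw [Real.log_mul ha0.ne' hb0.ne'] at this
      linarith
  have ha1 : ∑ i, a i = 1 := h1
  have hb1 : ∑ j, b j = 1 := by rw [hb, Finset.sum_comm]; exact h1
  have hab : ∑ i, ∑ j, a i * b j = 1 := by rw [← Finset.sum_mul_sum, ha1, hb1, one_mul]
  have hA : ∑ i, ∑ j, p i j * Real.log (a i) = -∑ i, Real.negMulLog (a i) := by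
    simp only [← Finset.sum_mul, Real.negMulLog, neg_mul, Finset.sum_neg_distrib, neg_neg]
    rfl
  have hB : ∑ i, ∑ j, p i j * Real.log (b j) = -∑ j, Real.negMulLog (b j) := by
    rw [Finset.sum_comm]
    simp only [← Finset.sum_mul, Real.negMulLog, neg_mul, Finset.sum_neg_distrib, neg_neg]
    rfl
  refine (Finset.sum_le_sum fun i _ => Finset.sum_le_sum fun j _ => hterm i j).trans_eq ?_
  simp only [Finset.sum_add_distrib, Finset.sum_sub_distrib, Finset.sum_neg_distrib, hA, hB, hab]
  rw [show ∑ i, ∑ j, p i j = 1 from h1]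
  simp only [ha, hb]
  ring

/-- In an eigenbasis of a mixture `∑ c_b S_b` of states each `S_b` has a probability distribution
`x b` on its diagonal, and the spectrum of the mixture is the mixture of these. -/
theorem exists_eigenbasis_distribution {ι m : Type*} [Fintype ι] [Fintype m] [DecidableEq m]
    {c : ι → ℝ} (hc : c ∈ stdSimplex ℝ ι) {S : ι → Matrix m m ℂ} (hS : ∀ b, IsState (S b)) :
    ∃ (U : Matrix m m ℂ) (x : ι → m → ℝ), Uᴴ * U = 1 ∧ (∀ b i, 0 ≤ x b i) ∧
      (∀ b, ∑ i, x b i = 1) ∧ (∀ b i, (Uᴴ * S b * U) i i = x b i) ∧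
      entropy (∑ b, (c b : ℂ) • S b) = ∑ i, Real.negMulLog (∑ b, c b * x b i) := by
  obtain ⟨U, d, hU, hU', -, hd⟩ := exists_eq_mul_diagonal_mul
    (posSemidef_sum Finset.univ fun b _ =>
      (hS b).1.smul (by exact_mod_cast hc.1 b : (0 : ℂ) ≤ (c b : ℂ)))
  have hpos : ∀ b i, 0 ≤ (Uᴴ * S b * U) i i := fun b i =>
    ((hS b).1.conjTranspose_mul_mul_same U).diag_nonneg
  refine ⟨U, fun b i => ((Uᴴ * S b * U) i i).re, hU, fun b i => (Complex.le_def.1 (hpos b i)).1,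
    fun b => ?_, fun b i => Complex.eq_re_of_ofReal_le (hpos b i), ?_⟩
  · have : (Uᴴ * S b * U).trace = 1 := by
      rw [trace_mul_cycle, hU', Matrix.one_mul, (hS b).2]
    rw [← Complex.re_sum]
    exact congrArg Complex.re this
  · rw [entropy]
    conv_lhs => rw [hd]
    rw [traceFun_mul_diagonal_mul Real.negMulLog_zero hU]
    refine Finset.sum_congr rfl fun i _ => ?_
    have := diag_conjTranspose_mul_sum_mul c S U i
    rw [hd, conjTranspose_mul_conj_mul hU, diagonal_apply_eq, Complex.ofReal_re] at this
    rw [this]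
    rfl

/-- Subadditivity of the von Neumann entropy, for separable states: in the product of the
eigenbases of the two marginals the diagonal is a joint distribution whose marginals are the two
spectra, and Peierls' inequality reduces the claim to Shannon entropies. -/
theorem entropy_sum_kronecker_le {ι m n : Type*} [Fintype ι] [Fintype m] [DecidableEq m]
    [Fintype n] [DecidableEq n] {c : ι → ℝ} (hc : c ∈ stdSimplex ℝ ι) {A : ι → Matrix m m ℂ}
    (hA : ∀ b, IsState (A b)) {B : ι → Matrix n n ℂ} (hB : ∀ b, IsState (B b)) :
    entropy (∑ b, (c b : ℂ) • (A b ⊗ₖ B b)) ≤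
      entropy (∑ b, (c b : ℂ) • A b) + entropy (∑ b, (c b : ℂ) • B b) := by
  have hc0 : ∀ b, (0 : ℂ) ≤ (c b : ℂ) := fun b => by exact_mod_cast hc.1 b
  obtain ⟨U, x, hU, hx0, hx1, hx, hSA⟩ := exists_eigenbasis_distribution hc hA
  obtain ⟨W, y, hW, hy0, hy1, hy, hSB⟩ := exists_eigenbasis_distribution hc hB
  have hUW : (U ⊗ₖ W)ᴴ * (U ⊗ₖ W) = 1 := by
    rw [conjTranspose_kronecker, ← mul_kronecker_mul, hU, hW, one_kronecker_one]
  have hS : (∑ b, (c b : ℂ) • (A b ⊗ₖ B b)).PosSemidef :=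
    posSemidef_sum _ fun b _ => ((hA b).1.kronecker (hB b).1).smul (hc0 b)
  have hentry : ∀ i j, (((U ⊗ₖ W)ᴴ * (∑ b, (c b : ℂ) • (A b ⊗ₖ B b)) * (U ⊗ₖ W)) (i, j) (i, j)).re =
      ∑ b, c b * (x b i * y b j) := fun i j => by
    rw [diag_conjTranspose_mul_sum_mul]
    refine Finset.sum_congr rfl fun b _ => ?_
    rw [conjTranspose_kronecker, ← mul_kronecker_mul, ← mul_kronecker_mul, kroneckerMap_apply, hx,
      hy, ← Complex.ofReal_mul, Complex.ofReal_re, smul_eq_mul]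
  have hrow : ∀ i, ∑ j, ∑ b, c b * (x b i * y b j) = ∑ b, c b * x b i := fun i => by
    rw [Finset.sum_comm]
    simp only [← Finset.mul_sum, hy1, mul_one]
  have hcol : ∀ j, ∑ i, ∑ b, c b * (x b i * y b j) = ∑ b, c b * y b j := fun j => by
    rw [Finset.sum_comm]
    simp only [← Finset.mul_sum, ← Finset.sum_mul, hx1, one_mul]
  have htot : ∑ i, ∑ j, ∑ b, c b * (x b i * y b j) = 1 := by
    simp only [hrow]
    rw [Finset.sum_comm]
    simp only [← Finset.mul_sum, hx1, mul_one]
    exact hc.2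
  have hsub := sum_negMulLog_le (p := fun i j => ∑ b, c b * (x b i * y b j))
    (fun i j => Finset.sum_nonneg fun b _ =>
      mul_nonneg (hc.1 b) (mul_nonneg (hx0 b i) (hy0 b j))) htot
  simp only [hrow, hcol] at hsub
  rw [hSA, hSB]
  refine (entropy_le_sum_diag hS hUW).trans ?_
  rw [Fintype.sum_prod_type]
  simpa only [hentry] using hsub

/-! ### States -/

theorem exists_isState (m : Type*) [Fintype m] [Nonempty m] :
    ∃ ρ : Matrix m m ℂ, IsState ρ := by
  classical
  obtain ⟨i⟩ := ‹Nonempty m›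
  refine ⟨diagonal (Pi.single i 1), PosSemidef.diagonal ?_, ?_⟩
  · exact Pi.single_nonneg.2 zero_le_one
  · simp [trace_diagonal]

theorem exists_isState_smul {m : Type*} [Fintype m] [Nonempty m] {A : Matrix m m ℂ}
    (hA : A.PosSemidef) : ∃ ρ, IsState ρ ∧ A = A.trace • ρ := by
  by_cases h : A.trace = 0
  · obtain ⟨ρ, hρ⟩ := exists_isState m
    exact ⟨ρ, hρ, by rw [h, zero_smul, ← hA.trace_eq_zero_iff, h]⟩
  · refine ⟨A.trace⁻¹ • A, ⟨hA.smul (inv_nonneg.2 hA.trace_nonneg), ?_⟩, ?_⟩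
    · rw [trace_smul, smul_eq_mul, inv_mul_cancel₀ h]
    · rw [smul_smul, mul_inv_cancel₀ h, one_smul]

theorem isState_sum_smul {ι m : Type*} [Fintype ι] [Fintype m] {c : ι → ℝ}
    (hc : c ∈ stdSimplex ℝ ι) {A : ι → Matrix m m ℂ} (hA : ∀ b, IsState (A b)) :
    IsState (∑ b, (c b : ℂ) • A b) := by
  refine ⟨posSemidef_sum _ fun b _ => (hA b).1.smul ?_, ?_⟩
  · exact_mod_cast hc.1 b
  · simp only [trace_sum, trace_smul, (hA _).2, smul_eq_mul, mul_one]
    exact_mod_cast hc.2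

theorem IsState.kronecker {m n : Type*} [Fintype m] [Fintype n] {A : Matrix m m ℂ}
    {B : Matrix n n ℂ} (hA : IsState A) (hB : IsState B) : IsState (A ⊗ₖ B) :=
  ⟨hA.1.kronecker hB.1, by rw [trace_kronecker, hA.2, hB.2, one_mul]⟩

theorem isState_ketBra {n : Type*} [Fintype n] {v : EuclideanSpace ℂ n} (hv : ‖v‖ = 1) :
    IsState (ketBra v) := by
  refine ⟨posSemidef_vecMulVec_self_star _, ?_⟩
  have h := sum_star_mul_of_orthonormal (e := fun _ : Unit => v)
    ⟨fun _ => hv, fun i j hij => (hij (Subsingleton.elim i j)).elim⟩ () ()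
  rw [if_pos rfl] at h
  rw [← h]
  exact Finset.sum_congr rfl fun j _ => mul_comm _ _

theorem IsCPTP.isState_map {m m' : Type*} [Fintype m] [DecidableEq m] [Fintype m']
    [DecidableEq m'] {Ω : Matrix m m ℂ →ₗ[ℂ] Matrix m' m' ℂ} (hΩ : IsCPTP Ω) {ρ : Matrix m m ℂ}
    (hρ : IsState ρ) : IsState (Ω ρ) := by
  refine ⟨?_, (hΩ.2 ρ).trans hρ.2⟩
  have h := hΩ.1 1 ((1 : Matrix (Fin 1) (Fin 1) ℂ) ⊗ₖ ρ) (PosSemidef.one.kronecker hρ.1)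
  rw [tensorMap_kronecker] at h
  convert h.submatrix (fun i : m' => ((0 : Fin 1), i)) using 1
  ext i j
  simp

/-! ### Measuring one half of a bipartite state -/

/-- The partial trace over the first tensor factor. -/
def partialTraceLeft {m n : Type*} [Fintype m] (τ : Matrix (m × n) (m × n) ℂ) : Matrix n n ℂ :=
  ∑ i, τ.submatrix (Prod.mk i) (Prod.mk i)

/-- The matrix `Tr₂ (τ (1 ⊗ X))`: the unnormalized state in which the first factor is left when
the effect `X` is observed on the second one. -/
def partialTraceWith {m n : Type*} [Fintype n] (X : Matrix n n ℂ) :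
    Matrix (m × n) (m × n) ℂ →ₗ[ℂ] Matrix m m ℂ where
  toFun τ := of fun i i' => ∑ j, ∑ j', τ (i, j) (i', j') * X j' j
  map_add' A B := by
    ext i i'
    simp [add_mul, Finset.sum_add_distrib]
  map_smul' c A := by
    ext i i'
    simp [Finset.mul_sum, mul_assoc]

theorem partialTraceWith_kronecker {m n : Type*} [Fintype n] (X : Matrix n n ℂ)
    (A : Matrix m m ℂ) (B : Matrix n n ℂ) :
    partialTraceWith X (A ⊗ₖ B) = (B * X).trace • A := by
  ext i i'
  simp only [partialTraceWith, LinearMap.coe_mk, AddHom.coe_mk, of_apply, kroneckerMap_apply,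
    Matrix.smul_apply, smul_eq_mul, trace, diag_apply, Matrix.mul_apply, Finset.sum_mul]
  exact Finset.sum_congr rfl fun j _ => Finset.sum_congr rfl fun j' _ => by ring

theorem trace_partialTraceWith {m n : Type*} [Fintype m] [Fintype n] (X : Matrix n n ℂ)
    (τ : Matrix (m × n) (m × n) ℂ) :
    (partialTraceWith X τ).trace = (partialTraceLeft τ * X).trace := by
  simp only [partialTraceWith, partialTraceLeft, LinearMap.coe_mk, AddHom.coe_mk, of_apply, trace,
    diag_apply, Matrix.mul_apply, Matrix.sum_apply, submatrix_apply, Finset.sum_mul]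
  rw [Finset.sum_comm]

theorem posSemidef_partialTraceWith {m n : Type*} [Fintype m] [Fintype n] {X : Matrix n n ℂ}
    (hX : X.PosSemidef) {τ : Matrix (m × n) (m × n) ℂ} (hτ : τ.PosSemidef) :
    (partialTraceWith X τ).PosSemidef := by
  classical
  obtain ⟨U, d, -, -, hd, rfl⟩ := exists_eq_mul_diagonal_mul hX
  let V : n → Matrix (m × n) m ℂ := fun a => of fun p i => if p.1 = i then U p.2 a else 0
  have h : partialTraceWith (U * diagonal (fun i => (d i : ℂ)) * Uᴴ) τ =
      ∑ a, (d a : ℂ) • ((V a)ᴴ * τ * V a) := by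
    ext i i'
    have h1 : ∀ a, ((V a)ᴴ * τ * V a) i i' =
        ∑ j, ∑ j', star (U j a) * τ (i, j) (i', j') * U j' a := fun a => by
      simp only [Matrix.mul_apply, conjTranspose_apply, V, of_apply, Fintype.sum_prod_type,
        mul_ite, mul_zero, apply_ite star, star_zero, ite_mul, zero_mul]
      rw [Finset.sum_comm]
      simp [Finset.sum_ite_eq', Finset.sum_mul]
      exact Finset.sum_comm
    simp only [partialTraceWith, LinearMap.coe_mk, AddHom.coe_mk, of_apply, Matrix.sum_apply,
      Matrix.smul_apply, smul_eq_mul, h1, Finset.mul_sum]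
    rw [Finset.sum_comm
      (f := fun a j => ∑ j', (d a : ℂ) * (star (U j a) * τ (i, j) (i', j') * U j' a))]
    refine Finset.sum_congr rfl fun j _ => ?_
    rw [Finset.sum_comm]
    refine Finset.sum_congr rfl fun j' _ => ?_
    rw [Matrix.mul_apply, Finset.mul_sum]
    refine Finset.sum_congr rfl fun a _ => ?_
    rw [mul_diagonal, conjTranspose_apply]
    ring
  rw [h]
  exact posSemidef_sum _ fun a _ =>
    (hτ.conjTranspose_mul_mul_same (V a)).smul (by exact_mod_cast hd a)

theorem isState_partialTraceLeft {m n : Type*} [Fintype m] [Fintype n]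
    {τ : Matrix (m × n) (m × n) ℂ} (hτ : IsState τ) : IsState (partialTraceLeft τ) := by
  refine ⟨posSemidef_sum _ fun i _ => hτ.1.submatrix _, ?_⟩
  rw [← hτ.2, partialTraceLeft, trace_sum]
  simp only [trace, diag_apply, submatrix_apply, Fintype.sum_prod_type]

theorem tensorMap_measurePrepare {m m' n n' : Type*} [Fintype m] [DecidableEq m] [Fintype m']
    [DecidableEq m'] [Fintype n] [DecidableEq n] [Fintype n'] [DecidableEq n']
    (Ω : Matrix m m ℂ →ₗ[ℂ] Matrix m' m' ℂ) {k : ℕ} (X : Fin k → Matrix n n ℂ)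
    (Q : Fin k → Matrix n' n' ℂ) (τ : Matrix (m × n) (m × n) ℂ) :
    tensorMap Ω (measurePrepare X Q) τ = ∑ b, Ω (partialTraceWith (X b) τ) ⊗ₖ Q b := by
  obtain ⟨t, rfl⟩ := (kroneckerLinearEquiv m m n n ℂ).surjective τ
  induction t with
  | zero => simp
  | add t u ht hu => simp only [map_add, ht, hu, add_kronecker, Finset.sum_add_distrib]
  | tmul A B =>
    rw [kroneckerLinearEquiv_tmul, tensorMap_kronecker]
    simp only [partialTraceWith_kronecker, map_smul, smul_kronecker]
    ext ⟨i, j⟩ ⟨i', j'⟩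
    simp only [measurePrepare, LinearMap.coe_mk, AddHom.coe_mk, kroneckerMap_apply,
      Matrix.sum_apply, Matrix.smul_apply, smul_eq_mul, Finset.mul_sum]
    exact Finset.sum_congr rfl fun b _ => by ring

/-- The output of `Ω ⊗ Φ` is a mixture of product states `Ω ρ_b ⊗ Q_b`; the weights are the
probabilities of the outcomes `b` when the POVM is measured on the second half of `τ`. -/
theorem exists_tensorMap_measurePrepare_eq {m m' n n' : Type*} [Fintype m] [DecidableEq m]
    [Nonempty m] [Fintype m'] [DecidableEq m'] [Fintype n] [DecidableEq n] [Fintype n']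
    [DecidableEq n'] (Ω : Matrix m m ℂ →ₗ[ℂ] Matrix m' m' ℂ) {k : ℕ} {X : Fin k → Matrix n n ℂ}
    (hX : IsPOVM X) (Q : Fin k → Matrix n' n' ℂ) {τ : Matrix (m × n) (m × n) ℂ}
    (hτ : IsState τ) :
    ∃ (x : Fin k → ℝ) (ρ : Fin k → Matrix m m ℂ), x ∈ stdSimplex ℝ (Fin k) ∧
      (∀ b, IsState (ρ b)) ∧
      tensorMap Ω (measurePrepare X Q) τ = ∑ b, (x b : ℂ) • (Ω (ρ b) ⊗ₖ Q b) ∧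
      measurePrepare X Q (partialTraceLeft τ) = ∑ b, (x b : ℂ) • Q b := by
  have hpos := fun b => posSemidef_partialTraceWith (hX.1 b) hτ.1
  choose ρ hρ hρ' using fun b => exists_isState_smul (hpos b)
  have hx : ∀ b, (partialTraceWith (X b) τ).trace =
      ((partialTraceWith (X b) τ).trace.re : ℂ) := fun b =>
    Complex.eq_re_of_ofReal_le (hpos b).trace_nonneg
  refine ⟨fun b => (partialTraceWith (X b) τ).trace.re, ρ, ⟨fun b => ?_, ?_⟩, hρ, ?_, ?_⟩
  · exact (Complex.le_def.1 (hpos b).trace_nonneg).1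
  · rw [← Complex.re_sum]
    simp only [trace_partialTraceWith]
    rw [← trace_sum, ← Finset.mul_sum, hX.2, Matrix.mul_one, (isState_partialTraceLeft hτ).2]
    rfl
  · rw [tensorMap_measurePrepare]
    refine Finset.sum_congr rfl fun b _ => ?_
    rw [← hx, ← smul_kronecker, ← map_smul, ← hρ']
  · rw [measurePrepare, LinearMap.coe_mk, AddHom.coe_mk]
    refine Finset.sum_congr rfl fun b _ => ?_
    rw [← hx, trace_partialTraceWith]

theorem isState_measurePrepare {n n' : Type*} [Fintype n] [DecidableEq n] [Fintype n'] {k : ℕ}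
    {X : Fin k → Matrix n n ℂ} (hX : IsPOVM X) {Q : Fin k → Matrix n' n' ℂ}
    (hQ : ∀ b, IsState (Q b)) {σ : Matrix n n ℂ} (hσ : IsState σ) :
    IsState (measurePrepare X Q σ) := by
  classical
  -- `σ` is the marginal of a bipartite state whose first factor is trivial
  have h1 : IsState ((1 : Matrix (Fin 1) (Fin 1) ℂ) ⊗ₖ σ) :=
    IsState.kronecker ⟨PosSemidef.one, by simp⟩ hσ
  have h2 : partialTraceLeft ((1 : Matrix (Fin 1) (Fin 1) ℂ) ⊗ₖ σ) = σ := by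
    ext i j
    simp [partialTraceLeft]
  obtain ⟨x, -, hx, -, -, h⟩ := exists_tensorMap_measurePrepare_eq LinearMap.id hX Q h1
  rw [h2] at h
  rw [h]
  exact isState_sum_smul hx hQ

theorem measurePrepare_ketBra {n n' : Type*} [Fintype n] {k : ℕ} {e : Fin k → EuclideanSpace ℂ n}
    (he : Orthonormal ℂ e) (Q : Fin k → Matrix n' n' ℂ) (b : Fin k) :
    measurePrepare (fun c => ketBra (e c)) Q (ketBra (e b)) = Q b := by
  have h : ∀ c, (ketBra (e b) * ketBra (e c)).trace = if b = c then 1 else 0 := fun c => by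
    have h1 := sum_star_mul_of_orthonormal he b c
    have h2 := sum_star_mul_of_orthonormal he c b
    have : (ketBra (e b) * ketBra (e c)).trace =
        (∑ j, star (e b j) * e c j) * ∑ j, star (e c j) * e b j := by
      rw [Finset.sum_mul_sum, Finset.sum_comm]
      simp only [trace, diag_apply, Matrix.mul_apply, ketBra, vecMulVec_apply]
      exact Finset.sum_congr rfl fun i _ => Finset.sum_congr rfl fun j _ => by ring
    rw [this, h1, h2]
    by_cases hbc : b = c <;> simp [hbc]
  simp [measurePrepare, h]

/-! ### Multiplicativity of the maximal output norm -/

theorem lpNorm_le_maxOutputNorm {m m' : Type*} [Fintype m] [Fintype m'] [DecidableEq m'] {p : ℝ}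
    (hp : 1 ≤ p) (Φ : Matrix m m ℂ →ₗ[ℂ] Matrix m' m' ℂ) {ρ : Matrix m m ℂ} (hρ : IsState ρ) :
    lpNorm p (Φ ρ) ≤ maxOutputNorm p Φ :=
  le_csSup (bddAbove_lpNorm hp Φ) ⟨ρ, hρ, rfl⟩

theorem maxOutputNorm_le {m m' : Type*} [Fintype m] [Nonempty m] [Fintype m'] [DecidableEq m']
    {p : ℝ} {Φ : Matrix m m ℂ →ₗ[ℂ] Matrix m' m' ℂ} {c : ℝ}
    (h : ∀ ρ, IsState ρ → lpNorm p (Φ ρ) ≤ c) : maxOutputNorm p Φ ≤ c := by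
  obtain ⟨ρ, hρ⟩ := exists_isState m
  refine csSup_le ⟨_, ρ, hρ, rfl⟩ ?_
  rintro _ ⟨ρ, hρ, rfl⟩
  exact h ρ hρ

theorem maxOutputNorm_nonneg {m m' : Type*} [Fintype m] [Nonempty m] [Fintype m']
    [DecidableEq m'] {p : ℝ} (hp : 1 ≤ p) {Φ : Matrix m m ℂ →ₗ[ℂ] Matrix m' m' ℂ}
    (hΦ : ∀ ρ, IsState ρ → IsState (Φ ρ)) : 0 ≤ maxOutputNorm p Φ := by
  obtain ⟨ρ, hρ⟩ := exists_isState m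
  exact (lpNorm_nonneg hp (hΦ ρ hρ).1).trans (lpNorm_le_maxOutputNorm hp Φ hρ)

section

variable {m m' n n' : Type*} [Fintype m] [DecidableEq m] [Nonempty m] [Fintype m']
  [DecidableEq m'] [Fintype n] [DecidableEq n] [Nonempty n] [Fintype n'] [DecidableEq n']
  {Ω : Matrix m m ℂ →ₗ[ℂ] Matrix m' m' ℂ} {Φ : Matrix n n ℂ →ₗ[ℂ] Matrix n' n' ℂ}

/-- The lower bound, from product states. -/
theorem maxOutputNorm_mul_le {p : ℝ} (hp : 1 ≤ p) (hΩ : ∀ ρ, IsState ρ → IsState (Ω ρ))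
    (hΦ : ∀ ρ, IsState ρ → IsState (Φ ρ)) :
    maxOutputNorm p Ω * maxOutputNorm p Φ ≤ maxOutputNorm p (tensorMap Ω Φ) := by
  have hprod : ∀ ρ, IsState ρ → ∀ σ, IsState σ →
      lpNorm p (Ω ρ) * lpNorm p (Φ σ) ≤ maxOutputNorm p (tensorMap Ω Φ) := by
    intro ρ hρ σ hσ
    rw [← lpNorm_kronecker hp (hΩ ρ hρ).1 (hΦ σ hσ).1, ← tensorMap_kronecker]
    exact lpNorm_le_maxOutputNorm hp _ (hρ.kronecker hσ)
  have hleft : ∀ σ, IsState σ →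
      maxOutputNorm p Ω * lpNorm p (Φ σ) ≤ maxOutputNorm p (tensorMap Ω Φ) := by
    intro σ hσ
    rcases (lpNorm_nonneg hp (hΦ σ hσ).1).eq_or_lt with h0 | h0
    · obtain ⟨ρ, hρ⟩ := exists_isState m
      have := hprod ρ hρ σ hσ
      rwa [← h0, mul_zero] at this ⊢
    · rw [← le_div_iff₀ h0]
      exact maxOutputNorm_le fun ρ hρ => (le_div_iff₀ h0).2 (hprod ρ hρ σ hσ)
  rcases (maxOutputNorm_nonneg hp hΩ).eq_or_lt with h0 | h0
  · obtain ⟨σ, hσ⟩ := exists_isState n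
    have := hleft σ hσ
    rwa [← h0, zero_mul] at this ⊢
  · rw [← le_div_iff₀' h0]
    exact maxOutputNorm_le fun σ hσ => (le_div_iff₀' h0).2 (hleft σ hσ)

/-- `Tr (·)^p` is convex, so that the output norm is bounded by that of the product states
`Ω ρ_b ⊗ Q_b`, and every `Q_b` is the output of `Φ` on `|e_b⟩⟨e_b|`. -/
theorem maxOutputNorm_tensorMap_le_of_isCQ {p : ℝ} (hp : 1 ≤ p)
    (hΩ : ∀ ρ, IsState ρ → IsState (Ω ρ)) (hΦ : IsCQ Φ) :
    maxOutputNorm p (tensorMap Ω Φ) ≤ maxOutputNorm p Ω * maxOutputNorm p Φ := by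
  obtain ⟨k, X, Q, hX, hQ, ⟨e, he⟩, rfl⟩ := hΦ
  have hΦs : ∀ σ, IsState σ → IsState (measurePrepare X Q σ) := fun σ hσ =>
    isState_measurePrepare hX hQ hσ
  have hν := mul_nonneg (maxOutputNorm_nonneg hp hΩ) (maxOutputNorm_nonneg hp hΦs)
  obtain rfl : X = fun b => ketBra (e b) := funext he
  have hQν : ∀ b, lpNorm p (Q b) ≤ maxOutputNorm p (measurePrepare (fun b => ketBra (e b)) Q) :=
    fun b => by
      have := lpNorm_le_maxOutputNorm hp (measurePrepare (fun b => ketBra (e b)) Q)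
        (isState_ketBra (e.orthonormal.1 b))
      rwa [measurePrepare_ketBra e.orthonormal] at this
  refine maxOutputNorm_le fun τ hτ => ?_
  obtain ⟨x, ρ, hx, hρ, hout, -⟩ := exists_tensorMap_measurePrepare_eq Ω hX Q hτ
  have hpos : ∀ b, (Ω (ρ b) ⊗ₖ Q b).PosSemidef := fun b =>
    (hΩ _ (hρ b)).1.kronecker (hQ b).1
  rw [hout, lpNorm_le_iff hp (posSemidef_sum _ fun b _ =>
    (hpos b).smul (by exact_mod_cast hx.1 b : (0 : ℂ) ≤ (x b : ℂ))) hν]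
  refine (traceFun_sum_smul_le (convexOn_rpow hp) (Real.zero_rpow (by positivity)) hpos hx).trans ?_
  have hb : ∀ b, traceFun (fun x => x ^ p) (Ω (ρ b) ⊗ₖ Q b) ≤
      (maxOutputNorm p Ω * maxOutputNorm p (measurePrepare (fun b => ketBra (e b)) Q)) ^ p := by
    intro b
    rw [← lpNorm_le_iff hp (hpos b) hν, lpNorm_kronecker hp (hΩ _ (hρ b)).1 (hQ b).1]
    exact mul_le_mul (lpNorm_le_maxOutputNorm hp Ω (hρ b)) (hQν b) (lpNorm_nonneg hp (hQ b).1)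
      (maxOutputNorm_nonneg hp hΩ)
  calc _ ≤ ∑ b, x b * _ := Finset.sum_le_sum fun b _ => mul_le_mul_of_nonneg_left (hb b) (hx.1 b)
    _ = _ := by rw [← Finset.sum_mul, hx.2, one_mul]

/-- The outputs are block diagonal with blocks `x_b Ω ρ_b`, where `x`, up to zeros, is the spectrum of
the output of `Φ` on the marginal; hence `‖·‖_p^p` is at most `ν_p(Ω)^p ∑ b, x_b^p`. -/
theorem maxOutputNorm_tensorMap_le_of_isQC {p : ℝ} (hp : 1 ≤ p)
    (hΩ : ∀ ρ, IsState ρ → IsState (Ω ρ)) (hΦ : IsQC Φ) :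
    maxOutputNorm p (tensorMap Ω Φ) ≤ maxOutputNorm p Ω * maxOutputNorm p Φ := by
  obtain ⟨k, X, Q, hX, hQ, ⟨e, he, hQe⟩, rfl⟩ := hΦ
  have h0 : (0 : ℝ) ^ p = 0 := Real.zero_rpow (by positivity)
  have hν := maxOutputNorm_nonneg hp hΩ
  refine maxOutputNorm_le fun τ hτ => ?_
  obtain ⟨x, ρ, hx, hρ, hout, hmarg⟩ := exists_tensorMap_measurePrepare_eq Ω hX Q hτ
  have hσ := isState_partialTraceLeft hτ
  have hΦσ := isState_measurePrepare hX hQ hσ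
  have hx0 : ∀ b, (0 : ℂ) ≤ (x b : ℂ) := fun b => by exact_mod_cast hx.1 b
  have hpos : ∀ b, ((x b : ℂ) • Ω (ρ b)).PosSemidef := fun b => (hΩ _ (hρ b)).1.smul (hx0 b)
  have hblock : ∀ b, traceFun (fun x => x ^ p) ((x b : ℂ) • Ω (ρ b)) ≤
      maxOutputNorm p Ω ^ p * x b ^ p := by
    intro b
    rw [traceFun_smul (g := fun y => (x b * y) ^ p) h0 (by simp [h0]) (x b) (fun _ _ => rfl)
      (hΩ _ (hρ b)).1, traceFun_eq_sum _ (hΩ _ (hρ b)).1.1]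
    have h1 := (lpNorm_le_iff hp (hΩ _ (hρ b)).1 hν).1 (lpNorm_le_maxOutputNorm hp Ω (hρ b))
    rw [traceFun_eq_sum _ (hΩ _ (hρ b)).1.1] at h1
    have h2 : ∀ i, (x b * (hΩ _ (hρ b)).1.1.eigenvalues i) ^ p =
        (hΩ _ (hρ b)).1.1.eigenvalues i ^ p * x b ^ p := fun i => by
      rw [Real.mul_rpow (hx.1 b) ((hΩ _ (hρ b)).1.eigenvalues_nonneg i), mul_comm]
    simp only [h2, ← Finset.sum_mul]
    exact mul_le_mul_of_nonneg_right h1 (Real.rpow_nonneg (hx.1 b) _)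
  have hout' : tensorMap Ω (measurePrepare X Q) τ =
      ∑ b, ((x b : ℂ) • Ω (ρ b)) ⊗ₖ ketBra (e b) := by
    rw [hout]
    exact Finset.sum_congr rfl fun b _ => by rw [smul_kronecker, hQe]
  have hkey : lpNorm p (tensorMap Ω (measurePrepare X Q) τ) ≤
      maxOutputNorm p Ω * lpNorm p (measurePrepare X Q (partialTraceLeft τ)) := by
    rw [hout', lpNorm_le_iff hp (posSemidef_sum _ fun b _ => (hpos b).kronecker (hQe b ▸ (hQ b).1))
      (mul_nonneg hν (lpNorm_nonneg hp hΦσ.1)), Real.mul_rpow hν (lpNorm_nonneg hp hΦσ.1),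
      ← traceFun_rpow_eq_lpNorm_rpow hp hΦσ.1, traceFun_sum_kronecker_ketBra h0 hpos he, hmarg]
    simp only [hQe]
    rw [traceFun_sum_smul_ketBra h0 he, Finset.mul_sum]
    exact Finset.sum_le_sum fun b _ => hblock b
  exact hkey.trans (mul_le_mul_of_nonneg_left (lpNorm_le_maxOutputNorm hp _ hσ) hν)

end

/-! ### Additivity of the Holevo capacity -/

theorem le_holevoCapacity {ι m m' : Type*} [Fintype ι] [Fintype m] [Fintype m'] [DecidableEq m']
    (Φ : Matrix m m ℂ →ₗ[ℂ] Matrix m' m' ℂ) {w : ι → ℝ} (hw : w ∈ stdSimplex ℝ ι)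
    {ρ : ι → Matrix m m ℂ} (hρ : ∀ i, IsState (ρ i)) :
    entropy (∑ i, (w i : ℂ) • Φ (ρ i)) - ∑ i, w i * entropy (Φ (ρ i)) ≤ holevoCapacity Φ := by
  let E := (Fintype.equivFin ι).symm
  refine le_csSup (bddAbove_holevoQuantity Φ) ⟨Fintype.card ι, w ∘ E, ρ ∘ E,
    ⟨fun i => hw.1 _, ?_⟩, fun i => hρ _, ?_⟩
  · rw [← hw.2]
    exact E.sum_comp w
  · rw [holevoQuantity]
    congr 1
    · congr 1
      exact E.sum_comp fun i => (w i : ℂ) • Φ (ρ i)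
    · exact E.sum_comp fun i => w i * entropy (Φ (ρ i))

theorem holevoCapacity_le {m m' : Type*} [Fintype m] [Nonempty m] [Fintype m'] [DecidableEq m']
    {Φ : Matrix m m ℂ →ₗ[ℂ] Matrix m' m' ℂ} {c : ℝ}
    (h : ∀ (k : ℕ) (π : Fin k → ℝ) (ρ : Fin k → Matrix m m ℂ), π ∈ stdSimplex ℝ (Fin k) →
      (∀ i, IsState (ρ i)) → holevoQuantity Φ π ρ ≤ c) : holevoCapacity Φ ≤ c := by
  obtain ⟨ρ, hρ⟩ := exists_isState m
  refine csSup_le ⟨_, 1, fun _ => 1, fun _ => ρ, ⟨by simp, by simp⟩, fun _ => hρ, rfl⟩ ?_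
  rintro _ ⟨k, π, ρ, hπ, hρ, rfl⟩
  exact h k π ρ hπ hρ

theorem entropy_zero {m : Type*} [Fintype m] [DecidableEq m] :
    entropy (0 : Matrix m m ℂ) = 0 := by
  simpa [entropy] using traceFun_mul_diagonal_mul (V := (1 : Matrix m m ℂ)) Real.negMulLog_zero
    (by simp) (fun _ => 0)

/-- The bound by the Holevo capacity for an ensemble whose weights need not sum to one. -/
theorem entropy_sum_smul_sub_le {ι m m' : Type*} [Fintype ι] [Fintype m] [Fintype m']
    [DecidableEq m'] {Ω : Matrix m m ℂ →ₗ[ℂ] Matrix m' m' ℂ}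
    (hΩ : ∀ ρ, IsState ρ → IsState (Ω ρ)) {w : ι → ℝ} (hw : ∀ i, 0 ≤ w i)
    {ρ : ι → Matrix m m ℂ} (hρ : ∀ i, IsState (ρ i)) :
    entropy (∑ i, (w i : ℂ) • Ω (ρ i)) - Real.negMulLog (∑ i, w i) -
      ∑ i, w i * entropy (Ω (ρ i)) ≤ (∑ i, w i) * holevoCapacity Ω := by
  rcases (Finset.sum_nonneg fun i (_ : i ∈ Finset.univ) => hw i).eq_or_lt with h | h
  · have h0 : ∀ i, w i = 0 := fun i =>
      (Finset.sum_eq_zero_iff_of_nonneg fun i _ => hw i).1 h.symm i (Finset.mem_univ i)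
    simp [h0, entropy_zero]
  set s := ∑ i, w i with hs
  have hv : (fun i => w i / s) ∈ stdSimplex ℝ ι :=
    ⟨fun i => div_nonneg (hw i) h.le, by rw [← Finset.sum_div, ← hs, div_self h.ne']⟩
  have hsum : ∑ i, (w i : ℂ) • Ω (ρ i) =
      (s : ℂ) • ∑ i, ((w i / s : ℝ) : ℂ) • Ω (ρ i) := by
    rw [Finset.smul_sum]
    refine Finset.sum_congr rfl fun i _ => ?_
    rw [smul_smul, ← Complex.ofReal_mul, mul_div_cancel₀ _ h.ne']
  have hent : ∑ i, w i * entropy (Ω (ρ i)) = s * ∑ i, w i / s * entropy (Ω (ρ i)) := by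
    rw [Finset.mul_sum]
    refine Finset.sum_congr rfl fun i _ => ?_
    rw [← mul_assoc, mul_div_cancel₀ _ h.ne']
  have := mul_le_mul_of_nonneg_left (le_holevoCapacity Ω hv hρ) h.le
  rw [hsum, hent, entropy_smul s (isState_sum_smul hv fun i => hΩ _ (hρ i))]
  linarith

section

variable {m m' n n' : Type*} [Fintype m] [DecidableEq m] [Nonempty m] [Fintype m']
  [DecidableEq m'] [Fintype n] [DecidableEq n] [Nonempty n] [Fintype n'] [DecidableEq n']
  {Ω : Matrix m m ℂ →ₗ[ℂ] Matrix m' m' ℂ} {Φ : Matrix n n ℂ →ₗ[ℂ] Matrix n' n' ℂ}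

theorem prod_mem_stdSimplex {ι κ : Type*} [Fintype ι] [Fintype κ] {v : ι → ℝ}
    (hv : v ∈ stdSimplex ℝ ι) {w : ι → κ → ℝ} (hw : ∀ i, w i ∈ stdSimplex ℝ κ) :
    (fun q : ι × κ => v q.1 * w q.1 q.2) ∈ stdSimplex ℝ (ι × κ) := by
  refine ⟨fun q => mul_nonneg (hv.1 _) ((hw _).1 _), ?_⟩
  rw [Fintype.sum_prod_type]
  simp only [← Finset.mul_sum, (hw _).2, mul_one, hv.2]

/-- The lower bound, from product ensembles. -/
theorem holevoCapacity_add_le (hΩ : ∀ ρ, IsState ρ → IsState (Ω ρ))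
    (hΦ : ∀ ρ, IsState ρ → IsState (Φ ρ)) :
    holevoCapacity Ω + holevoCapacity Φ ≤ holevoCapacity (tensorMap Ω Φ) := by
  have hprod : ∀ (k : ℕ) (v : Fin k → ℝ) (ρ : Fin k → Matrix m m ℂ), v ∈ stdSimplex ℝ (Fin k) →
      (∀ i, IsState (ρ i)) → ∀ (l : ℕ) (w : Fin l → ℝ) (σ : Fin l → Matrix n n ℂ),
      w ∈ stdSimplex ℝ (Fin l) → (∀ j, IsState (σ j)) →
      holevoQuantity Ω v ρ + holevoQuantity Φ w σ ≤ holevoCapacity (tensorMap Ω Φ) := by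
    intro k v ρ hv hρ l w σ hw hσ
    refine le_trans (le_of_eq ?_) (le_holevoCapacity (tensorMap Ω Φ)
      (prod_mem_stdSimplex hv fun _ => hw) (ρ := fun q => ρ q.1 ⊗ₖ σ q.2)
      fun q => (hρ q.1).kronecker (hσ q.2))
    have h1 : ∑ q : Fin k × Fin l, ((v q.1 * w q.2 : ℝ) : ℂ) • tensorMap Ω Φ (ρ q.1 ⊗ₖ σ q.2) =
        (∑ i, (v i : ℂ) • Ω (ρ i)) ⊗ₖ ∑ j, (w j : ℂ) • Φ (σ j) := by
      ext ⟨a, b⟩ ⟨a', b'⟩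
      simp only [tensorMap_kronecker, Matrix.sum_apply, Matrix.smul_apply, kroneckerMap_apply,
        smul_eq_mul, Fintype.sum_prod_type, Finset.sum_mul_sum, Complex.ofReal_mul]
      exact Finset.sum_congr rfl fun i _ => Finset.sum_congr rfl fun j _ => by ring
    have h2 : ∑ q : Fin k × Fin l, v q.1 * w q.2 * entropy (tensorMap Ω Φ (ρ q.1 ⊗ₖ σ q.2)) =
        ∑ i, v i * entropy (Ω (ρ i)) + ∑ j, w j * entropy (Φ (σ j)) := by
      simp only [tensorMap_kronecker, entropy_kronecker (hΩ _ (hρ _)) (hΦ _ (hσ _)),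
        Fintype.sum_prod_type, mul_add, Finset.sum_add_distrib]
      congr 1
      · refine Finset.sum_congr rfl fun i _ => ?_
        rw [← Finset.sum_mul, ← Finset.mul_sum, hw.2, mul_one]
      · rw [Finset.sum_comm]
        refine Finset.sum_congr rfl fun j _ => ?_
        rw [← Finset.sum_mul, ← Finset.sum_mul, hv.2, one_mul]
    rw [h1, h2, entropy_kronecker (isState_sum_smul hv fun i => hΩ _ (hρ i))
      (isState_sum_smul hw fun j => hΦ _ (hσ j)), holevoQuantity, holevoQuantity]
    ring
  have hleft : holevoCapacity Ω ≤ holevoCapacity (tensorMap Ω Φ) - holevoCapacity Φ :=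
    holevoCapacity_le fun k v ρ hv hρ => le_sub_comm.1 <|
      holevoCapacity_le fun l w σ hw hσ => le_sub_iff_add_le'.2 (hprod k v ρ hv hρ l w σ hw hσ)
  linarith

/-- Replacing each output by the mixture of products it is made of refines the ensemble; this
lowers the average entropy by concavity, and the entropy of the mean output is subadditive. -/
theorem holevoCapacity_tensorMap_le_of_isCQ (hΩ : ∀ ρ, IsState ρ → IsState (Ω ρ)) (hΦ : IsCQ Φ) :
    holevoCapacity (tensorMap Ω Φ) ≤ holevoCapacity Ω + holevoCapacity Φ := by
  obtain ⟨l, X, Q, hX, hQ, ⟨e, he⟩, rfl⟩ := hΦ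
  refine holevoCapacity_le fun k π τ hπ hτ => ?_
  choose x ρ hx hρ hout _ using fun i => exists_tensorMap_measurePrepare_eq Ω hX Q (hτ i)
  obtain rfl : X = fun b => ketBra (e b) := funext he
  have hw := prod_mem_stdSimplex hπ hx
  have hΩρ : ∀ i b, IsState (Ω (ρ i b)) := fun i b => hΩ _ (hρ i b)
  have h1 := le_holevoCapacity Ω hw (ρ := fun q => ρ q.1 q.2) fun q => hρ q.1 q.2
  have h2 := le_holevoCapacity (measurePrepare (fun b => ketBra (e b)) Q) hw
    (ρ := fun q => ketBra (e q.2)) fun q => isState_ketBra (e.orthonormal.1 q.2)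
  simp only [measurePrepare_ketBra e.orthonormal] at h2
  have h3 := entropy_sum_kronecker_le hw (fun q => hΩρ q.1 q.2) (fun q => hQ q.2)
  have hmean : ∑ i, (π i : ℂ) • tensorMap Ω (measurePrepare (fun b => ketBra (e b)) Q) (τ i) =
      ∑ q : Fin k × Fin l, ((π q.1 * x q.1 q.2 : ℝ) : ℂ) • (Ω (ρ q.1 q.2) ⊗ₖ Q q.2) := by
    simp only [hout, Finset.smul_sum, smul_smul, Complex.ofReal_mul, Fintype.sum_prod_type]
  have h4 : ∑ q : Fin k × Fin l, π q.1 * x q.1 q.2 * (entropy (Ω (ρ q.1 q.2)) + entropy (Q q.2)) ≤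
      ∑ i, π i * entropy (tensorMap Ω (measurePrepare (fun b => ketBra (e b)) Q) (τ i)) := by
    rw [Fintype.sum_prod_type]
    refine Finset.sum_le_sum fun i _ => ?_
    simp only [mul_assoc, ← Finset.mul_sum]
    refine mul_le_mul_of_nonneg_left ?_ (hπ.1 i)
    rw [hout]
    simp only [← entropy_kronecker (hΩρ i _) (hQ _)]
    exact sum_mul_entropy_le (fun b => ((hΩρ i b).kronecker (hQ b)).1) (hx i)
  simp only [mul_add, Finset.sum_add_distrib] at h4
  rw [holevoQuantity, hmean]
  linarith

/-- The outputs are block diagonal, so that their entropies split into the Shannon entropies of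
the outcome distributions, which are the output entropies of `Φ`, and one ensemble for `Ω` for
each outcome. -/
theorem holevoCapacity_tensorMap_le_of_isQC (hΩ : ∀ ρ, IsState ρ → IsState (Ω ρ)) (hΦ : IsQC Φ) :
    holevoCapacity (tensorMap Ω Φ) ≤ holevoCapacity Ω + holevoCapacity Φ := by
  obtain ⟨l, X, Q, hX, hQ, ⟨e, he, hQe⟩, rfl⟩ := hΦ
  obtain rfl : Q = fun b => ketBra (e b) := funext hQe
  refine holevoCapacity_le fun k π τ hπ hτ => ?_
  choose x ρ hx hρ hout hmarg using fun i =>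
    exists_tensorMap_measurePrepare_eq Ω hX (fun b => ketBra (e b)) (hτ i)
  have h0 := Real.negMulLog_zero
  have hΩρ : ∀ i b, IsState (Ω (ρ i b)) := fun i b => hΩ _ (hρ i b)
  have hw0 : ∀ i b, 0 ≤ π i * x i b := fun i b => mul_nonneg (hπ.1 i) ((hx i).1 b)
  have hsmul : ∀ {c : ℝ} {A : Matrix m' m' ℂ}, 0 ≤ c → IsState A → ((c : ℂ) • A).PosSemidef :=
    fun hc hA => hA.1.smul (by exact_mod_cast hc)
  -- the outputs of `Ω ⊗ Φ` and their mean
  have hSout : ∀ i, entropy (tensorMap Ω (measurePrepare X fun b => ketBra (e b)) (τ i)) =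
      ∑ b, Real.negMulLog (x i b) + ∑ b, x i b * entropy (Ω (ρ i b)) := fun i => by
    simp only [hout, ← smul_kronecker]
    rw [entropy, traceFun_sum_kronecker_ketBra h0 (fun b => hsmul ((hx i).1 b) (hΩρ i b)) he,
      ← Finset.sum_add_distrib]
    exact Finset.sum_congr rfl fun b _ => entropy_smul _ (hΩρ i b)
  have hSmean :
      entropy (∑ i, (π i : ℂ) • tensorMap Ω (measurePrepare X fun b => ketBra (e b)) (τ i)) =
      ∑ b, entropy (∑ i, ((π i * x i b : ℝ) : ℂ) • Ω (ρ i b)) := by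
    have : ∑ i, (π i : ℂ) • tensorMap Ω (measurePrepare X fun b => ketBra (e b)) (τ i) =
        ∑ b, (∑ i, ((π i * x i b : ℝ) : ℂ) • Ω (ρ i b)) ⊗ₖ ketBra (e b) := by
      ext ⟨a, c⟩ ⟨a', c'⟩
      simp only [hout, Matrix.sum_apply, Matrix.smul_apply, kroneckerMap_apply, smul_eq_mul,
        Finset.mul_sum, Finset.sum_mul, Complex.ofReal_mul]
      rw [Finset.sum_comm]
      exact Finset.sum_congr rfl fun b _ => Finset.sum_congr rfl fun i _ => by ring
    rw [this, entropy, traceFun_sum_kronecker_ketBra h0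
      (fun b => posSemidef_sum _ fun i _ => hsmul (hw0 i b) (hΩρ i b)) he]
    rfl
  -- the outputs of `Φ` for the marginal ensemble
  have hΦ := le_holevoCapacity (measurePrepare X fun b => ketBra (e b)) hπ
    (ρ := fun i => partialTraceLeft (τ i)) fun i => isState_partialTraceLeft (hτ i)
  have hΦmean : ∑ i, (π i : ℂ) • measurePrepare X (fun b => ketBra (e b)) (partialTraceLeft (τ i)) =
      ∑ b, ((∑ i, π i * x i b : ℝ) : ℂ) • ketBra (e b) := by
    simp only [hmarg, Finset.smul_sum, smul_smul, Complex.ofReal_sum, Finset.sum_smul,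
      Complex.ofReal_mul]
    exact Finset.sum_comm
  have hΦout : ∀ i, entropy (measurePrepare X (fun b => ketBra (e b)) (partialTraceLeft (τ i))) =
      ∑ b, Real.negMulLog (x i b) := fun i => by
    rw [hmarg, entropy, traceFun_sum_smul_ketBra h0 he]
  rw [hΦmean, entropy, traceFun_sum_smul_ketBra h0 he] at hΦ
  simp only [hΦout] at hΦ
  -- for each outcome, a weighted ensemble for `Ω`
  have hΩb := Finset.sum_le_sum fun b (_ : b ∈ Finset.univ) =>
    entropy_sum_smul_sub_le hΩ (w := fun i => π i * x i b) (fun i => hw0 i b)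
      (ρ := fun i => ρ i b) fun i => hρ i b
  have htot : ∑ b, ∑ i, π i * x i b = 1 := by
    rw [Finset.sum_comm]
    simp only [← Finset.mul_sum, (hx _).2, mul_one, hπ.2]
  rw [← Finset.sum_mul, htot, one_mul, Finset.sum_sub_distrib, Finset.sum_sub_distrib] at hΩb
  have hswap : ∑ i, π i * ∑ b, x i b * entropy (Ω (ρ i b)) =
      ∑ b, ∑ i, π i * x i b * entropy (Ω (ρ i b)) := by
    rw [Finset.sum_comm]
    simp only [Finset.mul_sum, mul_assoc]
  rw [holevoQuantity, hSmean]
  simp only [hSout, mul_add, Finset.sum_add_distrib]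
  rw [hswap]
  linarith

end

theorem isState_map_of_isCQ_or_isQC {n n' : Type*} [Fintype n] [DecidableEq n] [Fintype n']
    {Φ : Matrix n n ℂ →ₗ[ℂ] Matrix n' n' ℂ} (hΦ : IsCQ Φ ∨ IsQC Φ) {σ : Matrix n n ℂ}
    (hσ : IsState σ) : IsState (Φ σ) := by
  rcases hΦ with ⟨k, X, Q, hX, hQ, -, rfl⟩ | ⟨k, X, Q, hX, hQ, -, rfl⟩ <;>
  exact isState_measurePrepare hX hQ hσ

end QuantumChannel

theorem theorem1 {m m' n n' : Type*}
    [Fintype m] [DecidableEq m] [Nonempty m] [Fintype m'] [DecidableEq m']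
    [Fintype n] [DecidableEq n] [Nonempty n] [Fintype n'] [DecidableEq n']
    (Φ : Matrix n n ℂ →ₗ[ℂ] Matrix n' n' ℂ)
    (hΦ : QuantumChannel.IsCQ Φ ∨ QuantumChannel.IsQC Φ)
    (Ω : Matrix m m ℂ →ₗ[ℂ] Matrix m' m' ℂ) (hΩ : QuantumChannel.IsCPTP Ω) :
    (∀ p : ℝ, 1 ≤ p →
      QuantumChannel.maxOutputNorm p (QuantumChannel.tensorMap Ω Φ) =
        QuantumChannel.maxOutputNorm p Ω * QuantumChannel.maxOutputNorm p Φ) ∧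
    QuantumChannel.holevoCapacity (QuantumChannel.tensorMap Ω Φ) =
      QuantumChannel.holevoCapacity Ω + QuantumChannel.holevoCapacity Φ := by
  have hΩs : ∀ ρ, QuantumChannel.IsState ρ → QuantumChannel.IsState (Ω ρ) :=
    fun _ hρ => hΩ.isState_map hρ
  have hΦs : ∀ σ, QuantumChannel.IsState σ → QuantumChannel.IsState (Φ σ) :=
    fun _ hσ => QuantumChannel.isState_map_of_isCQ_or_isQC hΦ hσ
  refine ⟨fun p hp => le_antisymm ?_ (QuantumChannel.maxOutputNorm_mul_le hp hΩs hΦs),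
    le_antisymm ?_ (QuantumChannel.holevoCapacity_add_le hΩs hΦs)⟩
  · rcases hΦ with hΦ | hΦ
    · exact QuantumChannel.maxOutputNorm_tensorMap_le_of_isCQ hp hΩs hΦ
    · exact QuantumChannel.maxOutputNorm_tensorMap_le_of_isQC hp hΩs hΦ
  · rcases hΦ with hΦ | hΦ
    · exact QuantumChannel.holevoCapacity_tensorMap_le_of_isCQ hΩs hΦ
    · exact QuantumChannel.holevoCapacity_tensorMap_le_of_isQC hΩs hΦ
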